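/- Let $\lambda_p,\lambda_s,P_p,\sigma,\rho>0$, $\alpha>2$ and let $N\ge 1$ be an integer. Power beacons (PBs) form a homogeneous Poisson point process $\Phi_p=\{X_i\}$ of density $\lambda_p$ in $\mathbb R^2$. Sensor nodes form a homogeneous Poisson point process $\Phi_s$ of density $\lambda_s$ in $\mathbb R^2$, together with the typical sensor SN$_0$ at the origin. The disc of radius $\rho$ around a PB is its charging region and is divided into $N$ equal angular sectors (of arbitrary orientation). A sector is active if it contains at least one sensor. A PB with $M\ge 1$ active sectors radiates exactly in the angular directions of its active sectors (also beyond distance $\rho$), with gain $G_M=N/M$; a PB with $M=0$ active sectors radiates in all directions, with gain $G_0=1$. For a PB at $x$ and $0\le M\le N$, let $\eta^M(x)$ be the probability, over $\Phi_s$, that it has exactly $M$ active sectors and radiates towards SN$_0$. The PBs are assumed to be thinned independently according to these probabilities: conditionally on $\Phi_p$, the pairs (number $M_i$ of active sectors of the $i$-th PB, whether it radiates towards SN$_0$) are independent over $i$, and the $i$-th pair has the law, induced by $\Phi_s$, of this pair for a PB at $X_i$. The aggregate received power at SN$_0$ is $$P_s=\sum_i P_p\,G_{M_i}\,\sigma\,\max(\|X_i\|,1)^{-\alpha}\,\mathbf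 1[\text{the }i\text{-th PB radiates towards SN}_0],$$ and in omnidirectional transmission it is $P_s^{omni}=P_p\sigma\sum_i\max(\|X_i\|,1)^{-\alpha}$. Let $\gamma(a,x)=\int_0^x t^{a-1}e^{-t}\,dt$, $p=e^{-\lambda_s\pi\rho^2/N}$, $q=1-p$, $\eta_n^M=\binom{N-1}{M-1}p^{N-M}q^{M-1}$ and $\eta_f^M=\binom{N-1}{M-1}p^{N-M}q^{M}$ for $1\le M\le N$, and $\eta_f^0=p^N$. For $s\ge 0$ write $a_M=sP_p\sigma G_M$. Then both series converge almost surely and, for every $s\ge 0$, the Laplace transform $\mathcal L_{P_s}(s)=\mathbb E[e^{-sP_s}]$ is $$\mathcal L_{P_s}(s)=\prod_{M=1}^N \mathcal L_{n}^{M}(s)\ \prod_{M=0}^N\mathcal L_{f}^{M}(s),$$ where, if $0<\rho\le 1$, $$\mathcal L_n^M(s)=\exp\{-\lambda_p\pi\eta_n^M[\rho^2-\rho^2e^{-a_M}]\},$$ $$\mathcal L_f^M(s)=\exp\{\lambda_p\pi\eta_f^M[\rho^2-\rho^2e^{-a_M}-a_M^{2/\alpha}\gamma(1-\tfrac2\alpha,a_M)]\},$$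 and, if $\rho>1$, $$\mathcal L_n^M(s)=\exp\{-\lambda_p\pi\eta_n^M[\rho^2-\rho^2e^{-a_M\rho^{-\alpha}}+a_M^{2/\alpha}(\gamma(1-\tfrac2\alpha,a_M)-\gamma(1-\tfrac2\alpha,a_M\rho^{-\alpha}))]\},$$ $$\mathcal L_f^M(s)=\exp\{\lambda_p\pi\eta_f^M[\rho^2-\rho^2e^{-a_M\rho^{-\alpha}}-a_M^{2/\alpha}\gamma(1-\tfrac2\alpha,a_M\rho^{-\alpha})]\}.$$ If $N=1$, then $P_s=P_s^{omni}$ almost surely. Moreover, $$\mathcal L_{P_s^{omni}}(s)=\exp\{-\lambda_p\pi(sP_p\sigma)^{2/\alpha}\gamma(1-\tfrac2\alpha,sP_p\sigma)\}.$$ -/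

import Mathlib

open MeasureTheory ProbabilityTheory
open scoped ENNReal

noncomputable section

namespace WPT

/-! The plane is `ℂ`, with the Euclidean norm and Lebesgue measure. -/

/-- The (a.s. infinite) family of random points `X 0, X 1, …` of the plane is a homogeneous Poisson
point process of density `lam`: the number of points in a measurable set of finite area is Poisson
with mean `lam` times the area, and the numbers of points in pairwise disjoint measurable sets are
independent. -/
structure IsPoissonProcess {Ω : Type*} [MeasurableSpace Ω] (P : Measure Ω) (lam : ℝ)
    (X : ℕ → Ω → ℂ) : Prop where
  measurable : ∀ i, Measurable (X i)
  count_law : ∀ B : Set ℂ, MeasurableSet B → volume B < ∞ →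
    P.map (fun ω => {i : ℕ | X i ω ∈ B}.encard) =
      (poissonMeasure (lam * volume.real B).toNNReal).map (Nat.cast : ℕ → ℕ∞)
  count_indep : ∀ (n : ℕ) (B : Fin n → Set ℂ), (∀ j, MeasurableSet (B j)) →
    (Pairwise fun j k => Disjoint (B j) (B k)) →
    iIndepFun (fun (j : Fin n) (ω : Ω) => {i : ℕ | X i ω ∈ B j}.encard) P

/-- Independent marking of the points `X i` by marks `T i` in a countable set `κ`, where a point
located at `x` has mark `c` with probability `K x c`: conditionally on all the locations, the marks
are independent and `T i` has law `K (X i)`. Selecting the points whose mark lies in a given set is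
then an independent (location-dependent) thinning. -/
structure IsIndependentMarking {Ω κ : Type*} [MeasurableSpace Ω] [MeasurableSpace κ]
    (P : Measure Ω) (X : ℕ → Ω → ℂ) (K : ℂ → κ → ℝ≥0∞) (T : ℕ → Ω → κ) : Prop where
  measurable : ∀ i, Measurable (T i)
  joint_law : ∀ (n : ℕ) (A : Set (ℕ → ℂ)), MeasurableSet A → ∀ c : Fin n → κ,
    P {ω | (fun i => X i ω) ∈ A ∧ ∀ i : Fin n, T i ω = c i} =
      ∫⁻ ω in {ω | (fun i => X i ω) ∈ A}, ∏ i : Fin n, K (X i ω) (c i) ∂P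

/-! ### Sectors and beams of a power beacon -/

/-- The `k`-th of the `N` equal angular cones with apex `0`, `k = 0, …, N - 1`, rotated by the
angle `φ`. -/
def cone (N : ℕ) (φ : ℝ) (k : Fin N) : Set ℂ :=
  {z | -Real.pi + 2 * Real.pi * (k : ℝ) / N < (z * Complex.exp (-(φ * Complex.I))).arg ∧
    (z * Complex.exp (-(φ * Complex.I))).arg ≤ -Real.pi + 2 * Real.pi * ((k : ℝ) + 1) / N}

/-- The `k`-th sector of the charging region (the disc of radius `ρ`) of a power beacon located at
`x` whose sectors are oriented by the angle `φ`. -/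
def sector (N : ℕ) (ρ φ : ℝ) (x : ℂ) (k : Fin N) : Set ℂ :=
  {y | ‖y - x‖ ≤ ρ ∧ y - x ∈ cone N φ k}

/-- The active sectors of a power beacon at `x`: those with at least one sensor, when `S` is the set
of all sensors. -/
def activeSectors (N : ℕ) (ρ φ : ℝ) (S : Set ℂ) (x : ℂ) : Set (Fin N) :=
  {k | ∃ y ∈ S, y ∈ sector N ρ φ x k}

/-- The typical sensor, at the origin, is in a radiation direction of the power beacon at `x`:
either no sector is active and the beacon is omnidirectional, or the origin lies in the direction of
an active sector (inside or outside the charging region). -/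
def RadiatesToOrigin (N : ℕ) (ρ φ : ℝ) (S : Set ℂ) (x : ℂ) : Prop :=
  activeSectors N ρ φ S x = ∅ ∨ ∃ k ∈ activeSectors N ρ φ S x, 0 - x ∈ cone N φ k

/-- The set of all sensors: the points of the sensor process and the typical sensor at the
origin. -/
def sensors {Ω : Type*} (Y : ℕ → Ω → ℂ) (ω : Ω) : Set ℂ :=
  insert 0 (Set.range fun j => Y j ω)

open Classical in
/-- The probability, over the sensor process, that a power beacon at `x` has exactly `c.1` active
sectors and that it radiates (`c.2 = true`), or does not radiate (`c.2 = false`), towards the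
typical sensor. The sectors of a beacon at `x` are oriented by the angle `φ x`. -/
def stateProb {Ω : Type*} [MeasurableSpace Ω] (Q : Measure Ω) (Y : ℕ → Ω → ℂ)
    (N : ℕ) (ρ : ℝ) (φ : ℂ → ℝ) (x : ℂ) (c : ℕ × Bool) : ℝ≥0∞ :=
  Q {ω | (activeSectors N ρ (φ x) (sensors Y ω) x).ncard = c.1 ∧
    decide (RadiatesToOrigin N ρ (φ x) (sensors Y ω) x) = c.2}

/-! ### Received power -/

/-- The antenna gain `G_M` of a power beacon with `M` active sectors out of `N`. -/
def gain (N M : ℕ) : ℝ := if M = 0 then 1 else (N : ℝ) / M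

/-- The non-singular path loss at location `x`, for the path loss exponent `α`. -/
def pathLoss (α : ℝ) (x : ℂ) : ℝ := (max ‖x‖ 1) ^ (-α)

/-- The power received at the typical sensor from a power beacon at `x` with `c.1` active sectors
that radiates towards the origin iff `c.2 = true`. -/
def beaconPower (N : ℕ) (Pp σ α : ℝ) (x : ℂ) (c : ℕ × Bool) : ℝ :=
  if c.2 = true then Pp * gain N c.1 * σ * pathLoss α x else 0

/-- The aggregate received power at the typical sensor. -/
def aggregatePower {Ω : Type*} (N : ℕ) (Pp σ α : ℝ) (X : ℕ → Ω → ℂ) (T : ℕ → Ω → ℕ × Bool)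
    (ω : Ω) : ℝ :=
  ∑' i, beaconPower N Pp σ α (X i ω) (T i ω)

/-- The aggregate received power at the typical sensor when all power beacons are
omnidirectional. -/
def omniPower {Ω : Type*} (Pp σ α : ℝ) (X : ℕ → Ω → ℂ) (ω : Ω) : ℝ :=
  Pp * σ * ∑' i, pathLoss α (X i ω)

/-- The Laplace transform at `s` of the distribution of the random variable `Z`. -/
def laplace {Ω : Type*} [MeasurableSpace Ω] (P : Measure Ω) (Z : Ω → ℝ) (s : ℝ) : ℝ :=
  ∫ ω, Real.exp (-s * Z ω) ∂P

/-! ### The closed-form expressions -/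

/-- The lower incomplete gamma function `γ(a, x)`. -/
def lowerGamma (a x : ℝ) : ℝ := ∫ t in (0 : ℝ)..x, t ^ (a - 1) * Real.exp (-t)

/-- The probability `p` that a sector contains no point of the sensor process. -/
def emptyProb (N : ℕ) (lams ρ : ℝ) : ℝ := Real.exp (-(lams * Real.pi * ρ ^ 2 / N))

/-- `η_n^M`, for `1 ≤ M ≤ N`. -/
def etaNear (N : ℕ) (lams ρ : ℝ) (M : ℕ) : ℝ :=
  ((N - 1).choose (M - 1) : ℝ) * emptyProb N lams ρ ^ (N - M) *
    (1 - emptyProb N lams ρ) ^ (M - 1)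

/-- `η_f^M`, for `0 ≤ M ≤ N`. -/
def etaFar (N : ℕ) (lams ρ : ℝ) (M : ℕ) : ℝ :=
  if M = 0 then emptyProb N lams ρ ^ N
  else ((N - 1).choose (M - 1) : ℝ) * emptyProb N lams ρ ^ (N - M) *
    (1 - emptyProb N lams ρ) ^ M

/-- The factor of the near beacons with gain `G_M`, for `0 < ρ ≤ 1`. -/
def lapNearOne (N : ℕ) (lamp lams Pp σ ρ : ℝ) (M : ℕ) (s : ℝ) : ℝ :=
  Real.exp (-(lamp * Real.pi * etaNear N lams ρ M *
    (ρ ^ 2 - ρ ^ 2 * Real.exp (-(s * Pp * σ * gain N M)))))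

/-- The factor of the near beacons with gain `G_M`, for `1 < ρ`. -/
def lapNearTwo (N : ℕ) (lamp lams Pp σ α ρ : ℝ) (M : ℕ) (s : ℝ) : ℝ :=
  Real.exp (-(lamp * Real.pi * etaNear N lams ρ M *
    (ρ ^ 2 - ρ ^ 2 * Real.exp (-(s * Pp * σ * gain N M * ρ ^ (-α))) +
      (s * Pp * σ * gain N M) ^ (2 / α) *
        (lowerGamma (1 - 2 / α) (s * Pp * σ * gain N M) -
          lowerGamma (1 - 2 / α) (s * Pp * σ * gain N M * ρ ^ (-α))))))

/-- The factor of the far beacons with gain `G_M`, for `0 < ρ ≤ 1`. -/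
def lapFarOne (N : ℕ) (lamp lams Pp σ α ρ : ℝ) (M : ℕ) (s : ℝ) : ℝ :=
  Real.exp (lamp * Real.pi * etaFar N lams ρ M *
    (ρ ^ 2 - ρ ^ 2 * Real.exp (-(s * Pp * σ * gain N M)) -
      (s * Pp * σ * gain N M) ^ (2 / α) *
        lowerGamma (1 - 2 / α) (s * Pp * σ * gain N M)))

/-- The factor of the far beacons with gain `G_M`, for `1 < ρ`. -/
def lapFarTwo (N : ℕ) (lamp lams Pp σ α ρ : ℝ) (M : ℕ) (s : ℝ) : ℝ :=
  Real.exp (lamp * Real.pi * etaFar N lams ρ M *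
    (ρ ^ 2 - ρ ^ 2 * Real.exp (-(s * Pp * σ * gain N M * ρ ^ (-α))) -
      (s * Pp * σ * gain N M) ^ (2 / α) *
        lowerGamma (1 - 2 / α) (s * Pp * σ * gain N M * ρ ^ (-α))))

end WPT

end

/-!
The Laplace transform of the aggregate power is computed in three steps.

*Poisson sums.* For a nonnegative integrable `f`, the sum of `f` over a Poisson process satisfies
`E[exp (-∑ f (X i))] = exp (-lam * ∫ (1 - exp (-f)))` (`IsPoissonProcess.integral_exp_neg_tsum`).
For a step function this is the independence of the counts of disjoint sets together with the
transform of the Poisson law; in general both sides depend continuously on `f` in `L¹`, by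
Campbell's formula `IsPoissonProcess.lintegral_tsum_eq`.

*Marks.* Given the locations, the factors `exp (-s * power)` of the beacons are independent, so in
the mean of a finite product each factor is replaced by its conditional mean `meanFactor`
(`IsIndependentMarking.lintegral_prod`). The number of factors then tends to infinity, and the
first step applies to `f = -log meanFactor`, which is integrable because it is bounded by a multiple
of the path loss (`laplace_aggregatePower`).

*The law of a mark.* The `N` sectors of a beacon have equal area and are disjoint, so they contain
sensors of the process independently of each other, with probability `1 - emptyProb`; the sector
containing the origin is active anyway when the origin is within the charging distance. Counting
sets of active sectors gives `etaNear` and `etaFar` (`stateProb_eq`), which involve the location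
only through its norm, hence are measurable in the location for arbitrary orientations. The
exponent thus becomes a sum of integrals of `1 - exp (-a * pathLoss)` over a disc and over its
complement. Beyond the unit disc the integrand is `1 - exp (-a * r ^ (-α))`, for which
`tailPrimitive` gives an explicit radial primitive in terms of the lower incomplete gamma function.
-/

namespace WPT

open Filter Topology

/-! ### Poisson variables and the Laplace functional of a Poisson process -/

section Poisson

variable {Ω : Type*} [MeasurableSpace Ω]

lemma encard_eq_tsum_indicator {α : Type*} (x : ℕ → α) (B : Set α) :
    (({i : ℕ | x i ∈ B}.encard : ℕ∞) : ℝ≥0∞) = ∑' i, B.indicator 1 (x i) := by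
  rw [← ENNReal.tsum_set_one, tsum_subtype {i : ℕ | x i ∈ B} (fun _ => (1 : ℝ≥0∞))]
  rfl

lemma measurable_encard {X : ℕ → Ω → ℂ} (hX : ∀ i, Measurable (X i)) {B : Set ℂ}
    (hB : MeasurableSet B) : Measurable fun ω => {i : ℕ | X i ω ∈ B}.encard := by
  have h : Measurable fun ω => (({i : ℕ | X i ω ∈ B}.encard : ℕ∞) : ℝ≥0∞) := by
    simp_rw [encard_eq_tsum_indicator (fun i => X i _)]
    exact Measurable.tsum fun i => (measurable_one.indicator hB).comp (hX i)
  refine measurable_to_countable' fun k => ?_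
  have : (fun ω => {i : ℕ | X i ω ∈ B}.encard) ⁻¹' {k} =
      (fun ω => (({i : ℕ | X i ω ∈ B}.encard : ℕ∞) : ℝ≥0∞)) ⁻¹' {(k : ℝ≥0∞)} := by
    ext ω; simp
  rw [this]
  exact h (measurableSet_singleton _)

lemma lintegral_natCast_poissonMeasure (r : NNReal) :
    ∫⁻ n : ℕ, (n : ℝ≥0∞) ∂poissonMeasure r = r := by
  rw [poissonMeasure, lintegral_sum_measure]
  simp only [lintegral_smul_measure, lintegral_dirac, smul_eq_mul]
  rw [tsum_eq_zero_add' ENNReal.summable]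
  have h1 : ∀ n : ℕ, ENNReal.ofReal (Real.exp (-r) * r ^ (n + 1) / (n + 1).factorial) *
      ((n + 1 : ℕ) : ℝ≥0∞) = r * ENNReal.ofReal (Real.exp (-r) * r ^ n / n.factorial) := by
    intro n
    rw [← ENNReal.ofReal_natCast (n + 1), ← ENNReal.ofReal_coe_nnreal (p := r),
      ← ENNReal.ofReal_mul (by positivity), ← ENNReal.ofReal_mul (by positivity)]
    congr 1
    have : ((n.factorial : ℕ) : ℝ) ≠ 0 := by positivity
    rw [Nat.factorial_succ]
    push_cast
    field_simp
    ring
  simp_rw [h1]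
  rw [ENNReal.tsum_mul_left, ← ENNReal.ofReal_tsum_of_nonneg (fun n => by positivity)
    (hasSum_one_poissonMeasure r).summable, (hasSum_one_poissonMeasure r).tsum_eq]
  simp

lemma integral_exp_neg_mul_poissonMeasure (r : NNReal) (c : ℝ) :
    ∫ n : ℕ, Real.exp (-(c * n)) ∂poissonMeasure r =
      Real.exp (-(r * (1 - Real.exp (-c)))) := by
  rw [integral_poissonMeasure]
  have h : ∀ n : ℕ, (Real.exp (-r) * r ^ n / n.factorial) • Real.exp (-(c * n)) =
      Real.exp (-r) * ((r * Real.exp (-c)) ^ n / n.factorial) := by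
    intro n
    rw [mul_pow, ← Real.exp_nat_mul, smul_eq_mul, show (n : ℝ) * -c = -(c * n) by ring]
    ring
  simp_rw [h]
  rw [tsum_mul_left, (NormedSpace.expSeries_div_hasSum_exp (r * Real.exp (-c) : ℝ)).tsum_eq,
    ← Real.exp_eq_exp_ℝ, ← Real.exp_add]
  ring_nf

lemma abs_exp_neg_sub_exp_neg_le {x y : ℝ} (hx : 0 ≤ x) (hy : 0 ≤ y) :
    |Real.exp (-x) - Real.exp (-y)| ≤ |x - y| := by
  wlog h : x ≤ y generalizing x y
  · rw [abs_sub_comm, abs_sub_comm x]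
    exact this hy hx (le_of_not_ge h)
  have h1 : Real.exp (-y) = Real.exp (-x) * Real.exp (-(y - x)) := by
    rw [← Real.exp_add]; ring_nf
  have h2 : 1 - (y - x) ≤ Real.exp (-(y - x)) := by
    have := Real.add_one_le_exp (-(y - x)); linarith
  have h3 : Real.exp (-x) ≤ 1 := Real.exp_le_one_iff.2 (by linarith)
  have h4 : Real.exp (-(y - x)) ≤ 1 := Real.exp_le_one_iff.2 (by linarith)
  rw [abs_of_nonneg (sub_nonneg.2 (Real.exp_le_exp.2 (by linarith))),
    abs_of_nonpos (by linarith), h1]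
  nlinarith [Real.exp_pos (-x)]

namespace IsPoissonProcess

variable {P : Measure Ω} {lam : ℝ} {X : ℕ → Ω → ℂ}

lemma lintegral_encard (hX : IsPoissonProcess P lam X) (hlam : 0 < lam) {B : Set ℂ}
    (hB : MeasurableSet B) (hfin : volume B < ∞) :
    ∫⁻ ω, (({i : ℕ | X i ω ∈ B}.encard : ℕ∞) : ℝ≥0∞) ∂P = ENNReal.ofReal lam * volume B := by
  have hm := measurable_encard hX.measurable hB
  rw [← lintegral_map (f := fun k : ℕ∞ => (k : ℝ≥0∞)) .of_discrete hm, hX.count_law B hB hfin,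
    lintegral_map .of_discrete .of_discrete]
  simp only [ENat.toENNReal_coe]
  rw [lintegral_natCast_poissonMeasure, ← ENNReal.ofReal, ENNReal.ofReal_mul hlam.le,
    ofReal_measureReal hfin.ne]

/-- The intensity measure of a Poisson process is `lam` times the Lebesgue measure; the finiteness
of the area in `count_law` is removed by exhausting the plane by discs. -/
lemma sum_map_eq (hX : IsPoissonProcess P lam X) (hlam : 0 < lam) :
    Measure.sum (fun i => P.map (X i)) = ENNReal.ofReal lam • volume := by
  have key : ∀ B : Set ℂ, MeasurableSet B → volume B < ∞ →
      Measure.sum (fun i => P.map (X i)) B = ENNReal.ofReal lam * volume B := by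
    intro B hB hfin
    rw [← hX.lintegral_encard hlam hB hfin, Measure.sum_apply _ hB]
    simp_rw [encard_eq_tsum_indicator (fun i => X i _)]
    rw [lintegral_tsum (f := fun i ω => B.indicator 1 (X i ω)) fun i =>
      ((measurable_one.indicator hB).comp (hX.measurable i)).aemeasurable]
    congr 1 with i
    rw [← lintegral_map (f := B.indicator 1) (measurable_one.indicator hB) (hX.measurable i),
      lintegral_indicator_one hB]
  ext B hB
  have hU : B = ⋃ n : ℕ, B ∩ Metric.ball 0 n := by
    rw [← Set.inter_iUnion, Metric.iUnion_ball_nat, Set.inter_univ]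
  have hmono : Monotone fun n : ℕ => B ∩ Metric.ball (0 : ℂ) n := fun m n hmn =>
    Set.inter_subset_inter_right _ (Metric.ball_subset_ball (by exact_mod_cast hmn))
  rw [hU, hmono.measure_iUnion, hmono.measure_iUnion]
  refine iSup_congr fun n => ?_
  rw [key _ (hB.inter measurableSet_ball)
    ((measure_mono Set.inter_subset_right).trans_lt measure_ball_lt_top)]
  simp

/-- Campbell's formula for the mean of a sum over the points of the process. -/
lemma lintegral_tsum_eq (hX : IsPoissonProcess P lam X) (hlam : 0 < lam) {f : ℂ → ℝ≥0∞}
    (hf : Measurable f) :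
    ∫⁻ ω, ∑' i, f (X i ω) ∂P = ENNReal.ofReal lam * ∫⁻ x, f x := by
  rw [lintegral_tsum (f := fun i ω => f (X i ω)) fun i => (hf.comp (hX.measurable i)).aemeasurable]
  simp_rw [← lintegral_map hf (hX.measurable _)]
  rw [← lintegral_sum_measure, hX.sum_map_eq hlam, lintegral_smul_measure, smul_eq_mul]

lemma ae_summable (hX : IsPoissonProcess P lam X) (hlam : 0 < lam) {f : ℂ → ℝ}
    (hfm : Measurable f) (hf : Integrable f) : ∀ᵐ ω ∂P, Summable fun i => f (X i ω) := by
  have h := hX.lintegral_tsum_eq hlam (f := fun x => ‖f x‖ₑ) hfm.enorm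
  have hlt : ∫⁻ ω, ∑' i, ‖f (X i ω)‖ₑ ∂P ≠ ∞ := by
    rw [h]; exact ENNReal.mul_ne_top ENNReal.ofReal_ne_top hf.2.ne
  have hm : Measurable fun ω => ∑' i, ‖f (X i ω)‖ₑ :=
    Measurable.tsum fun i => (hfm.comp (hX.measurable i)).enorm
  filter_upwards [ae_lt_top hm hlt] with ω hω
  refine Summable.of_norm ?_
  have := ENNReal.summable_toReal hω.ne
  simpa using this

/-- The probability generating functional on step functions: a step function with level sets
`B j` makes the sum `∑ i, g (X i)` a linear combination of independent Poisson variables. -/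
lemma integral_exp_neg_tsum_simpleFunc [IsProbabilityMeasure P] (hX : IsPoissonProcess P lam X)
    (hlam : 0 < lam) (g : SimpleFunc ℂ ℝ) (hg : Integrable g) :
    ∫ ω, Real.exp (-∑' i, g (X i ω)) ∂P =
      Real.exp (-(lam * ∫ x, (1 - Real.exp (-g x)))) := by
  classical
  set S : Finset ℝ := g.range.filter (· ≠ 0) with hS
  set e := S.equivFin
  set v : Fin S.card → ℝ := fun j => (e.symm j : ℝ) with hv
  set B : Fin S.card → Set ℂ := fun j => g ⁻¹' {v j} with hB
  have hv0 : ∀ j, v j ≠ 0 := fun j => (Finset.mem_filter.1 (e.symm j).2).2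
  have hvinj : Function.Injective v := Subtype.val_injective.comp e.symm.injective
  have hBm : ∀ j, MeasurableSet (B j) := fun j => g.measurableSet_fiber _
  have hBfin : ∀ j, volume (B j) < ∞ := fun j =>
    SimpleFunc.measure_preimage_lt_top_of_integrable g hg (hv0 j)
  have hBdisj : Pairwise fun j k => Disjoint (B j) (B k) := by
    intro j k hjk
    refine Set.disjoint_left.2 fun x hx hx' => hjk (hvinj ?_)
    exact (show g x = v j from hx).symm.trans hx'
  -- The counts are a.s. finite, so that `ENat.toNat` loses nothing below.
  have hcnt : ∀ᵐ ω ∂P, ∀ j, {i : ℕ | X i ω ∈ B j}.Finite := by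
    refine ae_all_iff.2 fun j => ?_
    have h1 := hX.ae_summable hlam (f := (B j).indicator 1) (measurable_one.indicator (hBm j))
      (by
        rw [integrable_indicator_iff (hBm j)]
        exact integrableOn_const (hBfin j).ne)
    filter_upwards [h1] with ω hω
    have h2 := (hω.tendsto_cofinite_zero).eventually (gt_mem_nhds (zero_lt_one (α := ℝ)))
    rw [Filter.eventually_cofinite] at h2
    refine h2.subset fun i hi => ?_
    simp only [Set.mem_ofPred_eq] at hi ⊢
    simp [hi]
  have hgsum : ∀ x, g x = ∑ j, (B j).indicator (fun _ => v j) x := by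
    intro x
    by_cases hx : g x = 0
    · rw [hx, Finset.sum_eq_zero]
      intro j _
      refine Set.indicator_of_notMem (fun h => hv0 j ?_) _
      exact (show g x = v j from h).symm.trans hx
    · have hmem : g x ∈ S := Finset.mem_filter.2 ⟨g.mem_range_self x, hx⟩
      have hj : v (e ⟨g x, hmem⟩) = g x := by simp [hv]
      rw [Finset.sum_eq_single (e ⟨g x, hmem⟩)]
      · rw [Set.indicator_of_mem, hj]
        exact hj.symm
      · intro j _ hne
        refine Set.indicator_of_notMem (fun h => hne (hvinj ?_)) _
        rw [hj]; exact (show g x = v j from h).symm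
      · simp
  have hpt : ∀ᵐ ω ∂P, Real.exp (-∑' i, g (X i ω)) =
      ∏ j, Real.exp (-(v j * ({i : ℕ | X i ω ∈ B j}.encard.toNat : ℝ))) := by
    filter_upwards [hcnt] with ω hω
    have hsupp : ∀ j, (∑' i, (B j).indicator (fun _ => v j) (X i ω)) =
        v j * ({i : ℕ | X i ω ∈ B j}.encard.toNat : ℝ) := by
      intro j
      rw [tsum_eq_sum (s := (hω j).toFinset) (fun i hi => by
        refine Set.indicator_of_notMem (fun h => hi ?_) _
        simpa using h)]
      rw [Finset.sum_congr rfl (g := fun _ => v j) (fun i hi => by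
        refine Set.indicator_of_mem ?_ _
        simpa using hi)]
      rw [(hω j).encard_eq_coe_toFinset_card]
      simp [mul_comm]
    have hs : ∀ j, Summable fun i => (B j).indicator (fun _ => v j) (X i ω) := by
      intro j
      refine summable_of_hasFiniteSupport ((hω j).subset fun i hi => ?_)
      by_contra h
      exact hi (Set.indicator_of_notMem (s := B j) h _)
    simp_rw [hgsum]
    rw [Summable.tsum_finsetSum (fun j _ => hs j), ← Real.exp_sum, ← Finset.sum_neg_distrib]
    simp_rw [hsupp]
  rw [integral_congr_ae hpt]
  have hind := (hX.count_indep S.card B hBm hBdisj).comp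
    (fun j (k : ℕ∞) => Real.exp (-(v j * (k.toNat : ℝ)))) (fun j => .of_discrete)
  have hprod := hind.integral_fun_prod_eq_prod_integral (fun j =>
    ((Measurable.of_discrete (f := fun k : ℕ∞ => Real.exp (-(v j * (k.toNat : ℝ))))).comp
      (measurable_encard hX.measurable (hBm j))).aestronglyMeasurable)
  simp only [Function.comp_apply] at hprod
  rw [hprod]
  have hone : ∀ j, ∫ ω, Real.exp (-(v j * ({i : ℕ | X i ω ∈ B j}.encard.toNat : ℝ))) ∂P =
      Real.exp (-(lam * (volume.real (B j) * (1 - Real.exp (-v j))))) := by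
    intro j
    rw [← integral_map (φ := fun ω => {i : ℕ | X i ω ∈ B j}.encard)
      (f := fun k : ℕ∞ => Real.exp (-(v j * (k.toNat : ℝ))))
      (measurable_encard hX.measurable (hBm j)).aemeasurable .of_discrete,
      hX.count_law _ (hBm j) (hBfin j), integral_map .of_discrete .of_discrete]
    simp only [ENat.toNat_natCast]
    rw [integral_exp_neg_mul_poissonMeasure, Real.coe_toNNReal _ (by positivity), mul_assoc]
  simp_rw [hone]
  rw [← Real.exp_sum, Finset.sum_neg_distrib, ← Finset.mul_sum]
  congr 3
  have hexp : ∀ x, 1 - Real.exp (-g x) =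
      ∑ j, (B j).indicator (fun _ => 1 - Real.exp (-v j)) x := by
    intro x
    by_cases hx : ∃ j, x ∈ B j
    · obtain ⟨j, hj⟩ := hx
      rw [Finset.sum_eq_single j, Set.indicator_of_mem hj, show g x = v j from hj]
      · intro k _ hk
        exact Set.indicator_of_notMem (Set.disjoint_right.1 (hBdisj hk) hj) _
      · simp
    · push Not at hx
      have h0 : g x = 0 := by
        rw [hgsum x]; exact Finset.sum_eq_zero fun j _ => Set.indicator_of_notMem (hx j) _
      rw [h0, Finset.sum_eq_zero fun j _ => Set.indicator_of_notMem (hx j) _]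
      simp
  simp_rw [hexp]
  rw [integral_finsetSum _ fun j _ =>
    (integrable_indicator_iff (hBm j)).2 (integrableOn_const (hBfin j).ne)]
  refine Finset.sum_congr rfl fun j _ => ?_
  rw [integral_indicator (hBm j), setIntegral_const, smul_eq_mul]

lemma measurable_exp_neg_tsum (hX : IsPoissonProcess P lam X) {f : ℂ → ℝ} (hfm : Measurable f) :
    Measurable fun ω => Real.exp (-∑' i, f (X i ω)) :=
  (Measurable.tsum fun i => hfm.comp (hX.measurable i)).neg.exp

/-- Campbell's formula makes `f ↦ exp (-∑ i, f (X i))` Lipschitz in `L¹`. -/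
lemma lintegral_enorm_exp_neg_tsum_sub_le [IsProbabilityMeasure P] (hX : IsPoissonProcess P lam X)
    (hlam : 0 < lam) {f g : ℂ → ℝ} (hfm : Measurable f) (hgm : Measurable g)
    (hf : Integrable f) (hg : Integrable g) (hf0 : 0 ≤ f) (hg0 : 0 ≤ g) :
    ∫⁻ ω, ‖Real.exp (-∑' i, f (X i ω)) - Real.exp (-∑' i, g (X i ω))‖ₑ ∂P ≤
      ENNReal.ofReal lam * ∫⁻ x, ‖f x - g x‖ₑ := by
  rw [← hX.lintegral_tsum_eq hlam (f := fun x => ‖f x - g x‖ₑ) (hfm.sub hgm).enorm]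
  refine lintegral_mono_ae ?_
  filter_upwards [hX.ae_summable hlam hfm hf, hX.ae_summable hlam hgm hg] with ω h1 h2
  calc _ ≤ ‖(∑' i, f (X i ω)) - ∑' i, g (X i ω)‖ₑ := by
        rw [enorm_le_iff_norm_le, Real.norm_eq_abs, Real.norm_eq_abs]
        exact abs_exp_neg_sub_exp_neg_le (tsum_nonneg fun i => hf0 _)
          (tsum_nonneg fun i => hg0 _)
    _ = ‖∑' i, (f (X i ω) - g (X i ω))‖ₑ := by rw [h1.tsum_sub h2]
    _ ≤ _ := enorm_tsum_le_tsum_enorm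

/-- The probability generating functional of a Poisson process. Both sides are continuous in `f`
for the `L¹` norm, the left one by Campbell's formula, and step functions are dense. -/
theorem integral_exp_neg_tsum [IsProbabilityMeasure P] (hX : IsPoissonProcess P lam X)
    (hlam : 0 < lam) {f : ℂ → ℝ} (hfm : Measurable f) (hf : Integrable f) (hf0 : 0 ≤ f) :
    ∫ ω, Real.exp (-∑' i, f (X i ω)) ∂P =
      Real.exp (-(lam * ∫ x, (1 - Real.exp (-f x)))) := by
  have h0mem : (0 : ℝ) ∈ Set.Ici (0 : ℝ) := Set.self_mem_Ici
  set g : ℕ → SimpleFunc ℂ ℝ := fun n => SimpleFunc.approxOn f hfm (Set.Ici 0) 0 h0mem n with hgdef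
  have hgi : ∀ n, Integrable (g n) := fun n =>
    SimpleFunc.integrable_approxOn hfm hf h0mem (integrable_zero _ _ _) n
  have hg0 : ∀ n, 0 ≤ (g n : ℂ → ℝ) := fun n x => SimpleFunc.approxOn_mem hfm h0mem n x
  have hL1 : Tendsto (fun n => ∫⁻ x, ‖g n x - f x‖ₑ) atTop (𝓝 0) :=
    SimpleFunc.tendsto_approxOn_L1_enorm hfm h0mem
      (Eventually.of_forall fun x => subset_closure (hf0 x)) (by simpa using hf.2)
  have bdd : ∀ {h : ℂ → ℝ}, Measurable h → 0 ≤ h →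
      Integrable (fun ω => Real.exp (-∑' i, h (X i ω))) P := fun hm h0 =>
    Integrable.of_bound (hX.measurable_exp_neg_tsum hm).aestronglyMeasurable 1
      (Eventually.of_forall fun ω => by
        rw [Real.norm_eq_abs, abs_of_pos (Real.exp_pos _), Real.exp_le_one_iff, neg_nonpos]
        exact tsum_nonneg fun i => h0 _)
  have hl : Tendsto (fun n => ∫ ω, Real.exp (-∑' i, g n (X i ω)) ∂P) atTop
      (𝓝 (∫ ω, Real.exp (-∑' i, f (X i ω)) ∂P)) := by
    refine tendsto_integral_of_L1 _ (bdd hfm hf0).1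
      (Eventually.of_forall fun n => bdd (g n).measurable (hg0 n)) ?_
    refine tendsto_of_tendsto_of_tendsto_of_le_of_le tendsto_const_nhds
      (h := fun n => ENNReal.ofReal lam * ∫⁻ x, ‖g n x - f x‖ₑ) ?_ (fun _ => zero_le)
      (fun n => hX.lintegral_enorm_exp_neg_tsum_sub_le hlam (g n).measurable hfm (hgi n) hf
        (hg0 n) hf0)
    simpa using ENNReal.Tendsto.const_mul hL1 (Or.inr ENNReal.ofReal_ne_top)
  have int1 : ∀ {h : ℂ → ℝ}, Measurable h → Integrable h → 0 ≤ h →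
      Integrable (fun x => 1 - Real.exp (-h x)) := fun {h} hm hi h0 =>
    hi.mono' (measurable_const.sub hm.neg.exp).aestronglyMeasurable
      (Eventually.of_forall fun x => by
        have := abs_exp_neg_sub_exp_neg_le le_rfl (h0 x)
        simpa [abs_of_nonneg (h0 x)] using this)
  have hr : Tendsto (fun n => ∫ x, (1 - Real.exp (-g n x))) atTop
      (𝓝 (∫ x, (1 - Real.exp (-f x)))) := by
    refine tendsto_integral_of_L1 _ (int1 hfm hf hf0).1
      (Eventually.of_forall fun n => int1 (g n).measurable (hgi n) (hg0 n)) ?_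
    refine tendsto_of_tendsto_of_tendsto_of_le_of_le tendsto_const_nhds hL1 (fun _ => zero_le)
      (fun n => lintegral_mono fun x => ?_)
    rw [enorm_le_iff_norm_le, Real.norm_eq_abs, Real.norm_eq_abs]
    have := abs_exp_neg_sub_exp_neg_le (hg0 n x) (hf0 x)
    rwa [sub_sub_sub_cancel_left, abs_sub_comm]
  refine tendsto_nhds_unique hl ?_
  simp_rw [fun n => hX.integral_exp_neg_tsum_simpleFunc hlam (g n) (hgi n)]
  exact (Real.continuous_exp.tendsto _).comp (hr.const_mul lam).neg

end IsPoissonProcess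

end Poisson

/-! ### Integrating out independent marks -/

/-- A product of unordered sums over a countable type is the sum over all tuples. -/
lemma prod_tsum_fin {κ : Type*} : ∀ (n : ℕ) (f : Fin n → κ → ℝ≥0∞),
    ∏ i, ∑' c, f i c = ∑' c : Fin n → κ, ∏ i, f i (c i)
  | 0, f => by simp
  | n + 1, f => by
    rw [Fin.prod_univ_succ, prod_tsum_fin n, ← ENNReal.tsum_mul_right,
      ← (Fin.consEquiv fun _ => κ).tsum_eq, ENNReal.tsum_prod']
    refine tsum_congr fun c => ?_
    rw [← ENNReal.tsum_mul_left]
    refine tsum_congr fun d => ?_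
    simp [Fin.prod_univ_succ, Fin.consEquiv]

namespace IsIndependentMarking

variable {Ω κ : Type*} [MeasurableSpace Ω] [MeasurableSpace κ] {P : Measure Ω}
  {X : ℕ → Ω → ℂ} {K : ℂ → κ → ℝ≥0∞} {T : ℕ → Ω → κ}

lemma measurableSet_marks_eq [MeasurableSingletonClass κ]
    (hT : IsIndependentMarking P X K T) {n : ℕ} (c : Fin n → κ) :
    MeasurableSet {ω | ∀ i : Fin n, T i ω = c i} := by
  have : {ω | ∀ i : Fin n, T i ω = c i} = ⋂ i : Fin n, T i ⁻¹' {c i} := by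
    ext; simp
  rw [this]
  exact MeasurableSet.iInter fun i => hT.measurable i (measurableSet_singleton _)

/-- `joint_law` extended from events to functions of the locations. -/
lemma setLIntegral_marks_eq (hT : IsIndependentMarking P X K T)
    (hX : ∀ i, Measurable (X i))
    (hK : ∀ c, Measurable fun x => K x c) {n : ℕ} (c : Fin n → κ) {F : (ℕ → ℂ) → ℝ≥0∞}
    (hF : Measurable F) :
    ∫⁻ ω in {ω | ∀ i : Fin n, T i ω = c i}, F (fun i => X i ω) ∂P =
      ∫⁻ ω, (∏ i : Fin n, K (X i ω) (c i)) * F (fun i => X i ω) ∂P := by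
  have hXm : Measurable fun ω i => X i ω := measurable_pi_lambda _ hX
  have hKm : Measurable fun ω => ∏ i : Fin n, K (X i ω) (c i) :=
    Finset.measurable_prod _ fun i _ => (hK (c i)).comp (hX i)
  have hmap : (P.restrict {ω | ∀ i : Fin n, T i ω = c i}).map (fun ω i => X i ω) =
      (P.withDensity fun ω => ∏ i : Fin n, K (X i ω) (c i)).map (fun ω i => X i ω) := by
    ext A hA
    rw [Measure.map_apply hXm hA, Measure.map_apply hXm hA,
      Measure.restrict_apply (hXm hA), withDensity_apply _ (hXm hA)]
    exact hT.joint_law n A hA c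
  rw [← lintegral_map (f := F) hF hXm, hmap, lintegral_map hF hXm]
  exact lintegral_withDensity_eq_lintegral_mul _ hKm (hF.comp hXm)

/-- The marks can be integrated out one by one: a product over the first `n` marked points has the
same mean as the product of the conditional means of its factors given the locations. -/
theorem lintegral_prod [Countable κ] [MeasurableSingletonClass κ]
    (hT : IsIndependentMarking P X K T) (hX : ∀ i, Measurable (X i))
    (hK : ∀ c, Measurable fun x => K x c) {g : ℂ → κ → ℝ≥0∞}
    (hg : ∀ c, Measurable fun x => g x c) (n : ℕ) :
    ∫⁻ ω, ∏ i : Fin n, g (X i ω) (T i ω) ∂P =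
      ∫⁻ ω, ∏ i : Fin n, ∑' c, K (X i ω) c * g (X i ω) c ∂P := by
  have hU : (⋃ c : Fin n → κ, {ω | ∀ i : Fin n, T i ω = c i}) = Set.univ :=
    Set.eq_univ_of_forall fun ω => Set.mem_iUnion.2 ⟨fun i => T i ω, fun _ => rfl⟩
  have hdisj : Pairwise fun c d : Fin n → κ =>
      Disjoint {ω | ∀ i : Fin n, T i ω = c i} {ω | ∀ i : Fin n, T i ω = d i} := by
    intro c d hcd
    refine Set.disjoint_left.2 fun ω h1 h2 => hcd (funext fun i => ?_)
    rw [← h1 i, ← h2 i]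
  rw [← setLIntegral_univ, ← hU, lintegral_iUnion hT.measurableSet_marks_eq hdisj]
  simp_rw [prod_tsum_fin]
  rw [lintegral_tsum (f := fun (c : Fin n → κ) ω =>
      ∏ i : Fin n, K (X i ω) (c i) * g (X i ω) (c i))
    fun c => (Finset.measurable_prod _ fun i _ =>
    ((hK (c i)).mul (hg (c i))).comp (hX i)).aemeasurable]
  refine tsum_congr fun c => ?_
  rw [setLIntegral_congr_fun (g := fun ω => ∏ i : Fin n, g (X i ω) (c i))
    (hT.measurableSet_marks_eq c) fun ω hω => by
      refine Finset.prod_congr rfl fun i _ => ?_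
      rw [show T i ω = c i from hω i]]
  rw [hT.setLIntegral_marks_eq hX hK c (F := fun x => ∏ i : Fin n, g (x i) (c i))
    (Finset.measurable_prod _ fun i _ => (hg (c i)).comp (measurable_pi_apply _))]
  simp_rw [Finset.prod_mul_distrib]

/-- A mark which is impossible at every location a.s. does not occur. -/
lemma ae_ne [Countable κ] (hT : IsIndependentMarking P X K T) {c : κ} (hc : ∀ x, K x c = 0) :
    ∀ᵐ ω ∂P, ∀ i, T i ω ≠ c := by
  -- `joint_law` concerns the first `i + 1` marks jointly; the event is a countable union over them.
  refine ae_all_iff.2 fun i => ?_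
  have h : ∀ d : Fin (i + 1) → κ, d (Fin.last i) = c →
      P {ω | ∀ j : Fin (i + 1), T j ω = d j} = 0 := by
    intro d hd
    have := hT.joint_law (i + 1) Set.univ MeasurableSet.univ d
    simp only [Set.mem_univ, true_and] at this
    rw [this, lintegral_eq_zero_of_ae_eq_zero]
    refine Filter.Eventually.of_forall fun ω => ?_
    exact Finset.prod_eq_zero (Finset.mem_univ (Fin.last i)) (by rw [hd]; exact hc _)
  have h2 : ∀ᵐ ω ∂P, ∀ d : Fin (i + 1) → κ, d (Fin.last i) = c →
      ¬ ∀ j : Fin (i + 1), T j ω = d j := by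
    refine ae_all_iff.2 fun d => ?_
    by_cases hd : d (Fin.last i) = c
    · filter_upwards [measure_eq_zero_iff_ae_notMem.1 (h d hd)] with ω hω _ using hω
    · exact Filter.Eventually.of_forall fun ω h' => absurd h' hd
  filter_upwards [h2] with ω hω hTi
  exact hω (fun j => T j ω) (by simpa using hTi) fun _ => rfl

end IsIndependentMarking

/-! ### Cones and the area of a sector -/

/-- Measured in units of `2 * π / N` from the direction `-π`, the `k`-th cone is the interval
`(k, k + 1]`. -/
lemma mem_cone_iff {N : ℕ} (hN : 1 ≤ N) (φ : ℝ) (k : Fin N) (z : ℂ) :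
    z ∈ cone N φ k ↔
      (k : ℝ) < ((z * Complex.exp (-(φ * Complex.I))).arg + Real.pi) * N / (2 * Real.pi) ∧
      ((z * Complex.exp (-(φ * Complex.I))).arg + Real.pi) * N / (2 * Real.pi) ≤ (k : ℝ) + 1 := by
  have hN' : (0 : ℝ) < N := by exact_mod_cast hN
  have hpi := Real.pi_pos
  unfold cone
  rw [lt_div_iff₀ (by positivity), div_le_iff₀ (by positivity)]
  refine and_congr ?_ ?_
  · rw [neg_add_lt_iff_lt_add, div_lt_iff₀ hN']
    constructor <;> intro h <;> linarith
  · rw [le_neg_add_iff_add_le, le_div_iff₀ hN']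
    constructor <;> intro h <;> linarith

lemma exists_mem_cone {N : ℕ} (hN : 1 ≤ N) (φ : ℝ) (z : ℂ) : ∃ k : Fin N, z ∈ cone N φ k := by
  have hN' : (0 : ℝ) < N := by exact_mod_cast hN
  have hpi := Real.pi_pos
  set θ := (z * Complex.exp (-(φ * Complex.I))).arg with hθ
  set t : ℝ := (θ + Real.pi) * N / (2 * Real.pi) with ht
  have h1 : -Real.pi < θ := Complex.neg_pi_lt_arg _
  have h2 : θ ≤ Real.pi := Complex.arg_le_pi _
  have ht0 : 0 < t := by
    have : 0 < θ + Real.pi := by linarith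
    positivity
  have htN : t ≤ N := by
    rw [ht, div_le_iff₀ (by positivity)]
    nlinarith
  have hc0 : 0 < ⌈t⌉₊ := Nat.ceil_pos.2 ht0
  have hcN : ⌈t⌉₊ ≤ N := Nat.ceil_le.2 htN
  refine ⟨⟨⌈t⌉₊ - 1, by omega⟩, (mem_cone_iff hN φ _ z).2 ⟨?_, ?_⟩⟩
  · exact Nat.lt_ceil.1 (show ⌈t⌉₊ - 1 < ⌈t⌉₊ by omega)
  · have := Nat.le_ceil t
    simp only
    rw [Nat.cast_sub hc0]
    push_cast
    linarith

lemma eq_of_mem_cone {N : ℕ} (hN : 1 ≤ N) {φ : ℝ} {z : ℂ} {j k : Fin N} (hj : z ∈ cone N φ j)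
    (hk : z ∈ cone N φ k) : j = k := by
  rw [mem_cone_iff hN] at hj hk
  have h1 : (j : ℝ) < (k : ℝ) + 1 := hj.1.trans_le hk.2
  have h2 : (k : ℝ) < (j : ℝ) + 1 := hk.1.trans_le hj.2
  norm_cast at h1 h2
  exact Fin.ext (by omega)

lemma measurableSet_arg_sector (ρ a b : ℝ) :
    MeasurableSet {z : ℂ | ‖z‖ ≤ ρ ∧ a < z.arg ∧ z.arg ≤ b} :=
  (measurableSet_le measurable_norm measurable_const).inter
    ((measurableSet_lt measurable_const Complex.measurable_arg).inter
      (measurableSet_le Complex.measurable_arg measurable_const))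

lemma volume_arg_sector {ρ a b : ℝ} (hρ : 0 < ρ) (ha : -Real.pi ≤ a) (hb : b ≤ Real.pi) :
    volume {z : ℂ | ‖z‖ ≤ ρ ∧ a < z.arg ∧ z.arg ≤ b} =
      ENNReal.ofReal (ρ ^ 2 / 2) * ENNReal.ofReal (b - a) := by
  have hm := measurableSet_arg_sector ρ a b
  rw [← lintegral_indicator_one hm, ← Complex.lintegral_comp_polarCoord_symm]
  have hr : ∫⁻ r in Set.Ioc 0 ρ, ENNReal.ofReal r = ENNReal.ofReal (ρ ^ 2 / 2) := by
    rw [← ofReal_integral_eq_lintegral_ofReal]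
    · rw [← intervalIntegral.integral_of_le hρ.le, integral_id]; simp
    · exact (continuous_id.integrableOn_Icc).mono_set Set.Ioc_subset_Icc_self
    · filter_upwards [ae_restrict_mem measurableSet_Ioc] with r hr using hr.1.le
  -- The intersection with `Ioo (-π) π` comes from the target of the polar coordinates, and loses
  -- at most the point `π`.
  have hθ : volume (Set.Ioc a b ∩ Set.Ioo (-Real.pi) Real.pi) = ENNReal.ofReal (b - a) := by
    apply le_antisymm
    · rw [← Real.volume_Ioc]; exact measure_mono Set.inter_subset_left
    · rw [← Real.volume_Ioo]
      exact measure_mono fun t ht => ⟨⟨ht.1, ht.2.le⟩, ha.trans_lt ht.1, ht.2.trans_le hb⟩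
  have hset : ∫⁻ p in polarCoord.target, ENNReal.ofReal p.1 •
      {z : ℂ | ‖z‖ ≤ ρ ∧ a < z.arg ∧ z.arg ≤ b}.indicator 1 (Complex.polarCoord.symm p) =
      ∫⁻ p in Set.Ioc 0 ρ ×ˢ (Set.Ioc a b ∩ Set.Ioo (-Real.pi) Real.pi), ENNReal.ofReal p.1 := by
    rw [← lintegral_indicator polarCoord.open_target.measurableSet,
      ← lintegral_indicator (measurableSet_Ioc.prod (measurableSet_Ioc.inter measurableSet_Ioo))]
    congr 1 with p
    by_cases hp : p ∈ polarCoord.target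
    · have hp' : 0 < p.1 ∧ -Real.pi < p.2 ∧ p.2 < Real.pi := hp
      have hpc := Complex.polarCoord.right_inv (x := p) hp
      rw [Complex.polarCoord_apply] at hpc
      have e1 : ‖Complex.polarCoord.symm p‖ = p.1 := congrArg Prod.fst hpc
      have e2 : (Complex.polarCoord.symm p).arg = p.2 := congrArg Prod.snd hpc
      rw [Set.indicator_of_mem hp]
      by_cases hq : p.1 ≤ ρ ∧ a < p.2 ∧ p.2 ≤ b
      · rw [Set.indicator_of_mem (by rwa [Set.mem_ofPred_eq, e1, e2]), Set.indicator_of_mem]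
        · simp
        · exact ⟨⟨hp'.1, hq.1⟩, hq.2, hp'.2⟩
      · rw [Set.indicator_of_notMem (by rwa [Set.mem_ofPred_eq, e1, e2]), Set.indicator_of_notMem]
        · simp
        · exact fun h => hq ⟨h.1.2, h.2.1⟩
    · rw [Set.indicator_of_notMem hp, Set.indicator_of_notMem]
      exact fun h => hp ⟨h.1.1, h.2.2⟩
  rw [hset, Measure.volume_eq_prod, ← Measure.prod_restrict]
  have := lintegral_prod_mul (μ := volume.restrict (Set.Ioc 0 ρ))
    (ν := volume.restrict (Set.Ioc a b ∩ Set.Ioo (-Real.pi) Real.pi))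
    (f := ENNReal.ofReal) (g := 1) ENNReal.measurable_ofReal.aemeasurable aemeasurable_const
  simp only [Pi.one_apply, mul_one, lintegral_const, Measure.restrict_apply MeasurableSet.univ,
    Set.univ_inter, one_mul] at this
  rw [this, hr, hθ]

/-- The rigid motion that puts a beacon at the origin and its first sector at angle `-π`. -/
lemma measurePreserving_sub_mul_exp (x : ℂ) (φ : ℝ) :
    MeasurePreserving fun y : ℂ => (y - x) * Complex.exp (-(φ * Complex.I)) := by
  have h1 := (rotation (Circle.exp (-φ))).measurePreserving
  have h2 := measurePreserving_sub_right (volume : Measure ℂ) x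
  convert! h1.comp h2 using 1
  ext y
  simp only [Function.comp_apply, rotation_apply, Circle.coe_exp]
  push_cast
  rw [neg_mul, mul_comm]

lemma sector_eq_preimage {N : ℕ} (ρ φ : ℝ) (x : ℂ) (k : Fin N) :
    sector N ρ φ x k = (fun y : ℂ => (y - x) * Complex.exp (-(φ * Complex.I))) ⁻¹'
      {z : ℂ | ‖z‖ ≤ ρ ∧ -Real.pi + 2 * Real.pi * (k : ℝ) / N < z.arg ∧
        z.arg ≤ -Real.pi + 2 * Real.pi * ((k : ℝ) + 1) / N} := by
  ext y
  have : ‖Complex.exp (-(φ * Complex.I))‖ = 1 := by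
    rw [← neg_mul, ← Complex.ofReal_neg, Complex.norm_exp_ofReal_mul_I]
  simp [sector, cone, this]

lemma measurableSet_sector {N : ℕ} (ρ φ : ℝ) (x : ℂ) (k : Fin N) :
    MeasurableSet (sector N ρ φ x k) := by
  rw [sector_eq_preimage]
  exact (measurePreserving_sub_mul_exp x φ).measurable (measurableSet_arg_sector _ _ _)

lemma volume_sector {N : ℕ} (hN : 1 ≤ N) {ρ : ℝ} (hρ : 0 < ρ) (φ : ℝ) (x : ℂ) (k : Fin N) :
    volume (sector N ρ φ x k) = ENNReal.ofReal (Real.pi * ρ ^ 2 / N) := by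
  have hN' : (0 : ℝ) < N := by exact_mod_cast hN
  have hpi := Real.pi_pos
  have hk : (k : ℝ) + 1 ≤ N := by exact_mod_cast k.2
  rw [sector_eq_preimage, (measurePreserving_sub_mul_exp x φ).measure_preimage
    (measurableSet_arg_sector _ _ _).nullMeasurableSet, volume_arg_sector hρ,
    ← ENNReal.ofReal_mul (by positivity)]
  · congr 1
    field_simp
    ring
  · have : 0 ≤ 2 * Real.pi * (k : ℝ) / N := by positivity
    linarith
  · have : 2 * Real.pi * ((k : ℝ) + 1) / N ≤ 2 * Real.pi := by
      rw [div_le_iff₀ hN']; nlinarith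
    linarith

/-! ### Closed forms of the mark probabilities -/

/-- The probability that a beacon at `x` has exactly `M` active sectors and radiates towards the
origin, in closed form: `etaNear` within the charging distance, `etaFar` beyond it. -/
noncomputable def eta (N : ℕ) (lams ρ : ℝ) (x : ℂ) (M : ℕ) : ℝ :=
  if ‖x‖ ≤ ρ then (if M = 0 then 0 else etaNear N lams ρ M) else etaFar N lams ρ M

/-- The probability that a beacon at `x` has exactly `M` active sectors and does not radiate
towards the origin, in closed form. -/
noncomputable def etaOff (N : ℕ) (lams ρ : ℝ) (x : ℂ) (M : ℕ) : ℝ :=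
  if ‖x‖ ≤ ρ ∨ M = 0 then 0
  else ((N - 1).choose M : ℝ) * emptyProb N lams ρ ^ (N - M) * (1 - emptyProb N lams ρ) ^ M

/-- The law of the mark of a beacon at `x`, in closed form. -/
noncomputable def markProb (N : ℕ) (lams ρ : ℝ) (x : ℂ) (c : ℕ × Bool) : ℝ :=
  if c.2 then eta N lams ρ x c.1 else etaOff N lams ρ x c.1

@[simp]
lemma markProb_true (N : ℕ) (lams ρ : ℝ) (x : ℂ) (M : ℕ) :
    markProb N lams ρ x (M, true) = eta N lams ρ x M := if_pos rfl

@[simp]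
lemma markProb_false (N : ℕ) (lams ρ : ℝ) (x : ℂ) (M : ℕ) :
    markProb N lams ρ x (M, false) = etaOff N lams ρ x M := if_neg Bool.false_ne_true

/-- The probability that the sector with index `k` is active (`b = true`) or not (`b = false`):
the sector `k₀` containing the origin, when the origin is within the charging distance, is always
active. -/
noncomputable def sectorProb {N : ℕ} (lams ρ : ℝ) (x : ℂ) (k₀ k : Fin N) (b : Bool) : ℝ :=
  if ‖x‖ ≤ ρ ∧ k = k₀ then (if b then 1 else 0)
  else if b then 1 - emptyProb N lams ρ else emptyProb N lams ρ

lemma emptyProb_pos (N : ℕ) (lams ρ : ℝ) : 0 < emptyProb N lams ρ := Real.exp_pos _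

lemma emptyProb_le_one (N : ℕ) {lams : ℝ} (hlams : 0 < lams) (ρ : ℝ) : emptyProb N lams ρ ≤ 1 := by
  have := Real.pi_pos
  exact Real.exp_le_one_iff.2 (neg_nonpos.2 (by positivity))

lemma sectorProb_nonneg {N : ℕ} {lams : ℝ} (hlams : 0 < lams) (ρ : ℝ) (x : ℂ) (k₀ k : Fin N)
    (b : Bool) : 0 ≤ sectorProb lams ρ x k₀ k b := by
  have h1 := emptyProb_pos N lams ρ
  have h2 := emptyProb_le_one N hlams ρ
  unfold sectorProb
  split_ifs <;> linarith

/-! ### Summation over the sets of active sectors -/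

lemma card_filter_card_eq_notMem {N : ℕ} (k₀ : Fin N) (m : ℕ) :
    (Finset.univ.filter fun A : Finset (Fin N) => A.card = m ∧ k₀ ∉ A).card =
      (N - 1).choose m := by
  have : (Finset.univ.filter fun A : Finset (Fin N) => A.card = m ∧ k₀ ∉ A) =
      (Finset.univ.erase k₀).powersetCard m := by
    ext A
    simp only [Finset.mem_filter, Finset.mem_univ, true_and, Finset.mem_powersetCard,
      Finset.subset_erase, Finset.subset_univ]
    tauto
  rw [this, Finset.card_powersetCard, Finset.card_erase_of_mem (Finset.mem_univ _)]
  simp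

lemma card_filter_card_eq_mem {N : ℕ} (k₀ : Fin N) {m : ℕ} (hm : m ≠ 0) :
    (Finset.univ.filter fun A : Finset (Fin N) => A.card = m ∧ k₀ ∈ A).card =
      (N - 1).choose (m - 1) := by
  have h1 : (Finset.univ.filter fun A : Finset (Fin N) => A.card = m).card = N.choose m := by
    have : (Finset.univ.filter fun A : Finset (Fin N) => A.card = m) =
        (Finset.univ : Finset (Fin N)).powersetCard m := by
      ext A; simp
    rw [this, Finset.card_powersetCard]
    simp
  have h2 := Finset.card_filter_add_card_filter_not
    (s := Finset.univ.filter fun A : Finset (Fin N) => A.card = m) (fun A => k₀ ∈ A)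
  rw [Finset.filter_filter, Finset.filter_filter, h1, card_filter_card_eq_notMem] at h2
  obtain ⟨n, rfl⟩ : ∃ n, N = n + 1 := ⟨N - 1, by have := k₀.2; omega⟩
  obtain ⟨m, rfl⟩ := Nat.exists_eq_succ_of_ne_zero hm
  rw [Nat.succ_eq_add_one, Nat.choose_succ_succ] at h2
  simp only [Nat.succ_eq_add_one, Nat.add_sub_cancel] at h2 ⊢
  omega

lemma prod_sectorProb_far {N : ℕ} {lams ρ : ℝ} {x : ℂ} (hx : ¬ ‖x‖ ≤ ρ) (k₀ : Fin N)
    (A : Finset (Fin N)) :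
    ∏ k, sectorProb lams ρ x k₀ k (decide (k ∈ A)) =
      emptyProb N lams ρ ^ (N - A.card) * (1 - emptyProb N lams ρ) ^ A.card := by
  simp only [sectorProb, hx, false_and, if_false, decide_eq_true_eq]
  rw [Finset.prod_ite, Finset.prod_const, Finset.prod_const, mul_comm]
  congr 2
  · rw [Finset.filter_not, Finset.card_sdiff_of_subset (Finset.filter_subset _ _)]
    simp
  · simp

lemma prod_sectorProb_near {N : ℕ} {lams ρ : ℝ} {x : ℂ} (hx : ‖x‖ ≤ ρ) {k₀ : Fin N}
    {A : Finset (Fin N)} (hA : k₀ ∈ A) :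
    ∏ k, sectorProb lams ρ x k₀ k (decide (k ∈ A)) =
      emptyProb N lams ρ ^ (N - A.card) * (1 - emptyProb N lams ρ) ^ (A.card - 1) := by
  rw [← Finset.mul_prod_erase _ _ (Finset.mem_univ k₀)]
  have h0 : sectorProb lams ρ x k₀ k₀ (decide (k₀ ∈ A)) = 1 := by simp [sectorProb, hx, hA]
  have h1 : ∀ k ∈ Finset.univ.erase k₀, sectorProb lams ρ x k₀ k (decide (k ∈ A)) =
      if k ∈ A then 1 - emptyProb N lams ρ else emptyProb N lams ρ := by
    intro k hk
    simp [sectorProb, (Finset.mem_erase.1 hk).1]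
  rw [h0, one_mul, Finset.prod_congr rfl h1, Finset.prod_ite, Finset.prod_const, Finset.prod_const,
    mul_comm]
  have e1 : (Finset.univ.erase k₀).filter (· ∈ A) = A.erase k₀ := by
    ext; simp
  have e2 : (Finset.univ.erase k₀).filter (· ∉ A) = Finset.univ \ A := by
    ext k
    simp only [Finset.mem_filter, Finset.mem_erase, Finset.mem_univ, and_true, Finset.mem_sdiff,
      true_and, and_iff_right_iff_imp]
    rintro hk rfl
    exact hk hA
  rw [e1, e2, Finset.card_erase_of_mem hA, Finset.card_sdiff_of_subset (Finset.subset_univ A)]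
  simp

lemma prod_sectorProb_near_notMem {N : ℕ} {lams ρ : ℝ} {x : ℂ} (hx : ‖x‖ ≤ ρ) {k₀ : Fin N}
    {A : Finset (Fin N)} (hA : k₀ ∉ A) :
    ∏ k, sectorProb lams ρ x k₀ k (decide (k ∈ A)) = 0 :=
  Finset.prod_eq_zero (Finset.mem_univ k₀) (by simp [sectorProb, hx, hA])

/-- Summing the law of the set of active sectors over the sets of given cardinality that radiate
towards the cone `k₀`. -/
lemma sum_prod_sectorProb_true {N : ℕ} (lams ρ : ℝ) (x : ℂ) (k₀ : Fin N) (M : ℕ) :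
    ∑ A : Finset (Fin N) with A.card = M ∧ (A = ∅ ∨ k₀ ∈ A),
      ∏ k, sectorProb lams ρ x k₀ k (decide (k ∈ A)) = eta N lams ρ x M := by
  by_cases hM : M = 0
  · subst hM
    have : (Finset.univ.filter fun A : Finset (Fin N) => A.card = 0 ∧ (A = ∅ ∨ k₀ ∈ A)) = {∅} := by
      ext A; simp +contextual
    rw [this, Finset.sum_singleton]
    by_cases hx : ‖x‖ ≤ ρ
    · rw [prod_sectorProb_near_notMem hx (by simp)]
      simp [eta, hx]
    · rw [prod_sectorProb_far hx]
      simp [eta, hx, etaFar]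
  have hf : (Finset.univ.filter fun A : Finset (Fin N) => A.card = M ∧ (A = ∅ ∨ k₀ ∈ A)) =
      Finset.univ.filter fun A : Finset (Fin N) => A.card = M ∧ k₀ ∈ A := by
    ext A
    simp only [Finset.mem_filter, Finset.mem_univ, true_and, and_congr_right_iff,
      or_iff_right_iff_imp]
    rintro rfl rfl
    simp at hM
  rw [hf]
  by_cases hx : ‖x‖ ≤ ρ
  · rw [Finset.sum_congr rfl (g := fun _ => emptyProb N lams ρ ^ (N - M) *
      (1 - emptyProb N lams ρ) ^ (M - 1)), Finset.sum_const, card_filter_card_eq_mem k₀ hM]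
    · simp [eta, hx, hM, etaNear, mul_assoc]
    · intro A hA
      obtain ⟨_, h1, h2⟩ := Finset.mem_filter.1 hA
      rw [prod_sectorProb_near hx h2, h1]
  · rw [Finset.sum_congr rfl (g := fun _ => emptyProb N lams ρ ^ (N - M) *
      (1 - emptyProb N lams ρ) ^ M), Finset.sum_const, card_filter_card_eq_mem k₀ hM]
    · simp [eta, hx, hM, etaFar, mul_assoc]
    · intro A hA
      obtain ⟨_, h1, h2⟩ := Finset.mem_filter.1 hA
      rw [prod_sectorProb_far hx, h1]

/-- Summing the law of the set of active sectors over the sets of given cardinality that do not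
radiate towards the cone `k₀`. -/
lemma sum_prod_sectorProb_false {N : ℕ} (lams ρ : ℝ) (x : ℂ) (k₀ : Fin N) (M : ℕ) :
    ∑ A : Finset (Fin N) with A.card = M ∧ ¬ (A = ∅ ∨ k₀ ∈ A),
      ∏ k, sectorProb lams ρ x k₀ k (decide (k ∈ A)) = etaOff N lams ρ x M := by
  by_cases hM : M = 0
  · subst hM
    rw [Finset.filter_false_of_mem]
    · simp [etaOff]
    · rintro A - ⟨h1, h2⟩
      exact h2 (Or.inl (Finset.card_eq_zero.1 h1))
  by_cases hx : ‖x‖ ≤ ρ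
  · rw [Finset.sum_eq_zero]
    · simp [etaOff, hx]
    · intro A hA
      exact prod_sectorProb_near_notMem hx fun h => (Finset.mem_filter.1 hA).2.2 (Or.inr h)
  have hf : (Finset.univ.filter fun A : Finset (Fin N) => A.card = M ∧ ¬ (A = ∅ ∨ k₀ ∈ A)) =
      Finset.univ.filter fun A : Finset (Fin N) => A.card = M ∧ k₀ ∉ A := by
    ext A
    simp only [Finset.mem_filter, Finset.mem_univ, true_and, and_congr_right_iff, not_or,
      and_iff_right_iff_imp]
    rintro rfl _ rfl
    simp at hM
  rw [hf, Finset.sum_congr rfl (g := fun _ => emptyProb N lams ρ ^ (N - M) *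
      (1 - emptyProb N lams ρ) ^ M), Finset.sum_const, card_filter_card_eq_notMem k₀]
  · simp [etaOff, hx, hM, mul_assoc]
  · intro A hA
    obtain ⟨_, h1, h2⟩ := Finset.mem_filter.1 hA
    rw [prod_sectorProb_far hx, h1]

/-! ### The law of the active sectors -/

section ActiveSectors

variable {Ω : Type*} {lams : ℝ} {Y : ℕ → Ω → ℂ} {N : ℕ} {ρ φ : ℝ} {x : ℂ} {k₀ : Fin N}

lemma zero_mem_sector_iff (hN : 1 ≤ N) (hk₀ : 0 - x ∈ cone N φ k₀) (k : Fin N) :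
    0 ∈ sector N ρ φ x k ↔ ‖x‖ ≤ ρ ∧ k = k₀ := by
  simp only [sector, Set.mem_ofPred_eq]
  rw [zero_sub, norm_neg]
  refine and_congr_right fun _ => ⟨fun h => ?_, ?_⟩
  · rw [zero_sub] at hk₀
    exact eq_of_mem_cone hN h hk₀
  · rintro rfl
    simpa using hk₀

lemma mem_activeSectors_iff (hN : 1 ≤ N) (hk₀ : 0 - x ∈ cone N φ k₀) (ω : Ω) (k : Fin N) :
    k ∈ activeSectors N ρ φ (sensors Y ω) x ↔
      (‖x‖ ≤ ρ ∧ k = k₀) ∨ {j : ℕ | Y j ω ∈ sector N ρ φ x k}.encard ≠ 0 := by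
  rw [← zero_mem_sector_iff hN hk₀, Set.encard_ne_zero]
  simp only [activeSectors, sensors, Set.mem_ofPred_eq, Set.exists_mem_insert, Set.exists_range_iff]
  rfl

lemma radiatesToOrigin_iff (hN : 1 ≤ N) (hk₀ : 0 - x ∈ cone N φ k₀) (S : Set ℂ) :
    RadiatesToOrigin N ρ φ S x ↔
      activeSectors N ρ φ S x = ∅ ∨ k₀ ∈ activeSectors N ρ φ S x := by
  refine or_congr_right ⟨?_, fun h => ⟨k₀, h, hk₀⟩⟩
  rintro ⟨k, hk, hk'⟩
  rwa [← eq_of_mem_cone hN hk' hk₀]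

lemma pairwise_disjoint_sector (hN : 1 ≤ N) (ρ φ : ℝ) (x : ℂ) :
    Pairwise fun j k => Disjoint (sector N ρ φ x j) (sector N ρ φ x k) := fun _ _ hjk =>
  Set.disjoint_left.2 fun _ h1 h2 => hjk (eq_of_mem_cone hN h1.2 h2.2)

variable [MeasurableSpace Ω] {Q : Measure Ω}

lemma measure_encard_sector_eq_zero (hY : IsPoissonProcess Q lams Y) (hN : 1 ≤ N) (hlams : 0 < lams)
    (hρ : 0 < ρ) (k : Fin N) :
    Q {ω | {j : ℕ | Y j ω ∈ sector N ρ φ x k}.encard = 0} =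
      ENNReal.ofReal (emptyProb N lams ρ) := by
  have hm := measurableSet_sector ρ φ x k
  have hv := volume_sector hN hρ φ x k
  have h := hY.count_law _ hm (by rw [hv]; exact ENNReal.ofReal_lt_top)
  have h0 := congrArg (fun μ => μ {0}) h
  rw [Measure.map_apply (measurable_encard hY.measurable hm) (measurableSet_singleton _),
    Measure.map_apply .of_discrete (measurableSet_singleton _)] at h0
  have e : (Nat.cast : ℕ → ℕ∞) ⁻¹' {0} = {0} := by ext; simp
  rw [e, poissonMeasure_singleton] at h0
  have hpi := Real.pi_pos
  have hv' : volume.real (sector N ρ φ x k) = Real.pi * ρ ^ 2 / N := by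
    rw [measureReal_def, hv, ENNReal.toReal_ofReal (by positivity)]
  rw [hv', Real.coe_toNNReal _ (by positivity)] at h0
  simp only [pow_zero, Nat.factorial_zero, Nat.cast_one, mul_one, div_one] at h0
  rw [show lams * (Real.pi * ρ ^ 2 / N) = lams * Real.pi * ρ ^ 2 / N by ring] at h0
  exact h0

/-- The law of the set of active sectors: the sectors are disjoint, so their counts are
independent. -/
lemma measure_activeSectors_eq [IsProbabilityMeasure Q] (hY : IsPoissonProcess Q lams Y)
    (hN : 1 ≤ N) (hlams : 0 < lams) (hρ : 0 < ρ) (hk₀ : 0 - x ∈ cone N φ k₀)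
    (A : Finset (Fin N)) :
    MeasurableSet {ω | activeSectors N ρ φ (sensors Y ω) x = A} ∧
    Q {ω | activeSectors N ρ φ (sensors Y ω) x = A} =
      ENNReal.ofReal (∏ k, sectorProb lams ρ x k₀ k (decide (k ∈ A))) := by
  -- `S k` is the set of those values of the count of sector `k` for which it is active iff `k ∈ A`.
  set S : Fin N → Set ℕ∞ := fun k => {n | ((‖x‖ ≤ ρ ∧ k = k₀) ∨ n ≠ 0) ↔ k ∈ A} with hS
  have hm := fun k => measurableSet_sector (N := N) ρ φ x k
  have hcm := fun k => measurable_encard hY.measurable (hm k)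
  have hset : {ω | activeSectors N ρ φ (sensors Y ω) x = A} =
      ⋂ k ∈ Finset.univ, (fun ω => {j : ℕ | Y j ω ∈ sector N ρ φ x k}.encard) ⁻¹' S k := by
    ext ω
    simp only [Set.mem_ofPred_eq, Set.ext_iff, mem_activeSectors_iff hN hk₀, Finset.mem_univ,
      Set.iInter_true, Set.mem_iInter, Set.mem_preimage, hS, Finset.mem_coe]
  constructor
  · rw [hset]
    exact Finset.measurableSet_biInter _ fun k _ => hcm k .of_discrete
  have hind := hY.count_indep N _ hm (pairwise_disjoint_sector hN ρ φ x)
  rw [hset, hind.measure_inter_preimage_eq_mul _ (fun k _ => .of_discrete), ENNReal.ofReal_prod_of_nonneg fun k _ =>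
      sectorProb_nonneg hlams ρ x k₀ k _]
  refine Finset.prod_congr rfl fun k _ => ?_
  have h0 := measure_encard_sector_eq_zero (φ := φ) (x := x) hY hN hlams hρ k
  have h1 : Q {ω | {j : ℕ | Y j ω ∈ sector N ρ φ x k}.encard ≠ 0} =
      ENNReal.ofReal (1 - emptyProb N lams ρ) := by
    have := prob_compl_eq_one_sub (μ := Q) (hcm k (measurableSet_singleton 0))
    rw [ENNReal.ofReal_sub _ (emptyProb_pos N lams ρ).le, ENNReal.ofReal_one, ← h0]
    exact this
  by_cases hnear : ‖x‖ ≤ ρ ∧ k = k₀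
  · obtain ⟨hx, rfl⟩ := hnear
    by_cases hkA : k ∈ A
    · have : S k = Set.univ := by ext; simp [hS, hx, hkA]
      simp [this, sectorProb, hx, hkA]
    · have : S k = ∅ := by ext; simp [hS, hx, hkA]
      simp [this, sectorProb, hx, hkA]
  · by_cases hkA : k ∈ A
    · have : S k = {0}ᶜ := by ext; simp [hS, hnear, hkA]
      simp only [this, sectorProb, hnear, hkA, decide_true, if_true, if_false]
      exact h1
    · have : S k = {0} := by ext; simp [hS, hnear, hkA]
      simp only [this, sectorProb, hnear, hkA, decide_false, if_false, Bool.false_eq_true]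
      exact h0

/-- A property of the set of active sectors has the probability given by summing its law. -/
lemma measure_activeSectors_prop [IsProbabilityMeasure Q] (hY : IsPoissonProcess Q lams Y)
    (hN : 1 ≤ N) (hlams : 0 < lams) (hρ : 0 < ρ) (hk₀ : 0 - x ∈ cone N φ k₀)
    (p : Finset (Fin N) → Prop) [DecidablePred p] {E : Set Ω}
    (hE : ∀ (ω) (A : Finset (Fin N)),
      activeSectors N ρ φ (sensors Y ω) x = A → (ω ∈ E ↔ p A)) :
    MeasurableSet E ∧ Q E = ENNReal.ofReal
      (∑ A : Finset (Fin N) with p A, ∏ k, sectorProb lams ρ x k₀ k (decide (k ∈ A))) := by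
  have hset : E = ⋃ A ∈ Finset.univ.filter p,
      {ω | activeSectors N ρ φ (sensors Y ω) x = (A : Finset (Fin N))} := by
    ext ω
    simp only [Finset.mem_filter, Finset.mem_univ, true_and, Set.mem_iUnion, Set.mem_ofPred_eq,
      exists_prop]
    constructor
    · intro h
      have hA := ((activeSectors N ρ φ (sensors Y ω) x).toFinite.coe_toFinset).symm
      exact ⟨_, (hE ω _ hA).1 h, hA⟩
    · rintro ⟨A, hpA, hA⟩
      exact (hE ω A hA).2 hpA
  have hl := fun A => measure_activeSectors_eq hY hN hlams hρ hk₀ A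
  refine ⟨hset ▸ Finset.measurableSet_biUnion _ fun A _ => (hl A).1, ?_⟩
  rw [hset, measure_biUnion_finset _ fun A _ => (hl A).1, ENNReal.ofReal_sum_of_nonneg
    fun A _ => Finset.prod_nonneg fun k _ => sectorProb_nonneg hlams ρ x k₀ k _]
  · exact Finset.sum_congr rfl fun A _ => (hl A).2
  · intro A _ B _ hAB
    refine Set.disjoint_left.2 fun ω h1 h2 => hAB (Finset.coe_injective ?_)
    exact (show _ = _ from h1).symm.trans h2

end ActiveSectors

section StateProb

variable {Ω : Type*} [MeasurableSpace Ω] {Q : Measure Ω} [IsProbabilityMeasure Q] {lams : ℝ}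
  {Y : ℕ → Ω → ℂ} {N : ℕ} {ρ : ℝ}

/-- The events of `stateProb` are measurable and have the closed-form probabilities. In particular
these depend on the location only through its distance to the origin, whatever the orientations. -/
lemma measurableSet_and_stateProb_eq (hY : IsPoissonProcess Q lams Y) (hN : 1 ≤ N)
    (hlams : 0 < lams)
    (hρ : 0 < ρ) (φ : ℂ → ℝ) (x : ℂ) (c : ℕ × Bool) :
    MeasurableSet {ω | (activeSectors N ρ (φ x) (sensors Y ω) x).ncard = c.1 ∧
      @decide (RadiatesToOrigin N ρ (φ x) (sensors Y ω) x) (Classical.propDecidable _) = c.2} ∧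
    stateProb Q Y N ρ φ x c =
      ENNReal.ofReal (markProb N lams ρ x c) := by
  obtain ⟨k₀, hk₀⟩ := exists_mem_cone hN (φ x) (0 - x)
  obtain ⟨M, b⟩ := c
  cases b
  · rw [markProb_false, ← sum_prod_sectorProb_false lams ρ x k₀]
    refine measure_activeSectors_prop hY hN hlams hρ hk₀
      (fun A => A.card = M ∧ ¬ (A = ∅ ∨ k₀ ∈ A)) fun ω A hA => ?_
    simp [radiatesToOrigin_iff hN hk₀, hA]
  · rw [markProb_true, ← sum_prod_sectorProb_true lams ρ x k₀]
    refine measure_activeSectors_prop hY hN hlams hρ hk₀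
      (fun A => A.card = M ∧ (A = ∅ ∨ k₀ ∈ A)) fun ω A hA => ?_
    simp [radiatesToOrigin_iff hN hk₀, hA]

lemma stateProb_eq (hY : IsPoissonProcess Q lams Y) (hN : 1 ≤ N) (hlams : 0 < lams)
    (hρ : 0 < ρ) (φ : ℂ → ℝ) (x : ℂ) (c : ℕ × Bool) :
    stateProb Q Y N ρ φ x c =
      ENNReal.ofReal (markProb N lams ρ x c) :=
  (measurableSet_and_stateProb_eq hY hN hlams hρ φ x c).2

lemma tsum_stateProb (hY : IsPoissonProcess Q lams Y) (hN : 1 ≤ N) (hlams : 0 < lams)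
    (hρ : 0 < ρ) (φ : ℂ → ℝ) (x : ℂ) : ∑' c, stateProb Q Y N ρ φ x c = 1 := by
  unfold stateProb
  rw [← measure_iUnion _ fun c => (measurableSet_and_stateProb_eq hY hN hlams hρ φ x c).1,
    ← measure_univ (μ := Q)]
  · congr 1
    refine Set.eq_univ_of_forall fun ω => Set.mem_iUnion.2 ⟨(_, _), rfl, rfl⟩
  · intro c d hcd
    refine Set.disjoint_left.2 fun ω h1 h2 => hcd (Prod.ext ?_ ?_)
    · exact h1.1.symm.trans h2.1
    · exact h1.2.symm.trans h2.2

lemma measurable_eta (N : ℕ) (lams ρ : ℝ) (M : ℕ) : Measurable fun x => eta N lams ρ x M :=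
  Measurable.ite (measurableSet_le measurable_norm measurable_const) measurable_const
    measurable_const

lemma measurable_etaOff (N : ℕ) (lams ρ : ℝ) (M : ℕ) :
    Measurable fun x => etaOff N lams ρ x M := by
  refine Measurable.ite ?_ measurable_const measurable_const
  exact (measurableSet_le measurable_norm measurable_const).union (MeasurableSet.const _)

lemma measurable_markProb (N : ℕ) (lams ρ : ℝ) (c : ℕ × Bool) :
    Measurable fun x => markProb N lams ρ x c := by
  unfold markProb
  cases c.2
  · simpa using measurable_etaOff N lams ρ c.1
  · simpa using measurable_eta N lams ρ c.1

lemma measurable_stateProb (hY : IsPoissonProcess Q lams Y) (hN : 1 ≤ N) (hlams : 0 < lams)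
    (hρ : 0 < ρ) (φ : ℂ → ℝ) (c : ℕ × Bool) : Measurable fun x => stateProb Q Y N ρ φ x c := by
  simp_rw [stateProb_eq hY hN hlams hρ]
  exact (measurable_markProb N lams ρ c).ennreal_ofReal

end StateProb

lemma etaNear_nonneg (N : ℕ) {lams : ℝ} (hlams : 0 < lams) (ρ : ℝ) (M : ℕ) :
    0 ≤ etaNear N lams ρ M := by
  have h1 := emptyProb_pos N lams ρ
  have h2 := sub_nonneg.2 (emptyProb_le_one N hlams ρ)
  unfold etaNear; positivity

lemma etaFar_nonneg (N : ℕ) {lams : ℝ} (hlams : 0 < lams) (ρ : ℝ) (M : ℕ) :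
    0 ≤ etaFar N lams ρ M := by
  have h1 := emptyProb_pos N lams ρ
  have h2 := sub_nonneg.2 (emptyProb_le_one N hlams ρ)
  unfold etaFar; split_ifs <;> positivity

lemma eta_nonneg (N : ℕ) {lams : ℝ} (hlams : 0 < lams) (ρ : ℝ) (x : ℂ) (M : ℕ) :
    0 ≤ eta N lams ρ x M := by
  unfold eta; split_ifs
  exacts [le_rfl, etaNear_nonneg N hlams ρ M, etaFar_nonneg N hlams ρ M]

lemma etaOff_nonneg (N : ℕ) {lams : ℝ} (hlams : 0 < lams) (ρ : ℝ) (x : ℂ) (M : ℕ) :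
    0 ≤ etaOff N lams ρ x M := by
  have h1 := emptyProb_pos N lams ρ
  have h2 := sub_nonneg.2 (emptyProb_le_one N hlams ρ)
  unfold etaOff; split_ifs <;> positivity

lemma eta_eq_zero_of_lt {N : ℕ} (hN : 1 ≤ N) (lams ρ : ℝ) (x : ℂ) {M : ℕ} (hM : N < M) :
    eta N lams ρ x M = 0 := by
  have h : (N - 1).choose (M - 1) = 0 := Nat.choose_eq_zero_of_lt (by omega)
  have hM0 : M ≠ 0 := by omega
  simp [eta, etaNear, etaFar, h, hM0]

lemma etaOff_eq_zero_of_le {N : ℕ} (hN : 1 ≤ N) (lams ρ : ℝ) (x : ℂ) {M : ℕ} (hM : N ≤ M) :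
    etaOff N lams ρ x M = 0 := by
  have h : (N - 1).choose M = 0 := Nat.choose_eq_zero_of_lt (by omega)
  simp [etaOff, h]

/-! ### The incomplete gamma function and radial integrals -/

section RadialIntegrals

lemma intervalIntegrable_rpow_mul_exp {b : ℝ} (hb : 0 < b) (x y : ℝ) :
    IntervalIntegrable (fun t : ℝ => t ^ (b - 1) * Real.exp (-t)) volume x y :=
  (intervalIntegral.intervalIntegrable_rpow' (by linarith)).mul_continuousOn
    (by fun_prop)

lemma continuous_lowerGamma {b : ℝ} (hb : 0 < b) : Continuous (lowerGamma b) :=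
  intervalIntegral.continuous_primitive (intervalIntegrable_rpow_mul_exp hb) 0

lemma lowerGamma_zero (b : ℝ) : lowerGamma b 0 = 0 := intervalIntegral.integral_same

lemma hasDerivAt_lowerGamma {b x : ℝ} (hb : 0 < b) (hx : 0 < x) :
    HasDerivAt (lowerGamma b) (x ^ (b - 1) * Real.exp (-x)) x := by
  refine intervalIntegral.integral_hasDerivAt_right (intervalIntegrable_rpow_mul_exp hb 0 x)
    (Measurable.stronglyMeasurable (by fun_prop)).stronglyMeasurableAtFilter ?_
  exact (Real.continuousAt_rpow_const x _ (Or.inl hx.ne')).mul (by fun_prop)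

/-- Minus an antiderivative of `2 * r * (1 - exp (-a * r ^ (-α)))` which vanishes at infinity. -/
noncomputable def tailPrimitive (α a r : ℝ) : ℝ :=
  a ^ (2 / α) * lowerGamma (1 - 2 / α) (a * r ^ (-α)) -
    r ^ 2 * (1 - Real.exp (-(a * r ^ (-α))))

variable {α a : ℝ}

lemma hasDerivAt_tailPrimitive (hα : 2 < α) (ha : 0 < a) {r : ℝ} (hr : 0 < r) :
    HasDerivAt (tailPrimitive α a) (-(2 * r * (1 - Real.exp (-(a * r ^ (-α)))))) r := by
  have hα0 : 0 < α := by linarith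
  have hb : 0 < 1 - 2 / α := by
    rw [sub_pos, div_lt_one hα0]; exact hα
  have hu : HasDerivAt (fun r : ℝ => a * r ^ (-α)) (a * (-α * r ^ (-α - 1))) r :=
    (Real.hasDerivAt_rpow_const (Or.inl hr.ne')).const_mul a
  have hu0 : 0 < a * r ^ (-α) := by positivity
  have h1 := ((hasDerivAt_lowerGamma hb hu0).comp r hu).const_mul (a ^ (2 / α))
  have h2 := (hasDerivAt_pow 2 r).mul (hu.neg.exp.const_sub 1)
  refine (h1.sub h2).congr_deriv ?_
  have e1 : (a * r ^ (-α)) ^ (1 - 2 / α - 1) = a ^ (-(2 / α)) * r ^ 2 := by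
    rw [show 1 - 2 / α - 1 = -(2 / α) by ring, Real.mul_rpow ha.le (by positivity),
      ← Real.rpow_mul hr.le, show -α * -(2 / α) = (2 : ℕ) by push_cast; field_simp,
      Real.rpow_natCast]
  have e2 : a ^ (2 / α) * a ^ (-(2 / α)) = 1 := by
    rw [← Real.rpow_add ha]; simp
  rw [e1]
  simp only [Pi.neg_apply]
  push_cast
  linear_combination (r ^ 2 * Real.exp (-(a * r ^ (-α))) * (a * (-α * r ^ (-α - 1)))) * e2

lemma tendsto_tailPrimitive (hα : 2 < α) (ha : 0 < a) :
    Tendsto (tailPrimitive α a) atTop (𝓝 0) := by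
  have hα0 : 0 < α := by linarith
  have hb : 0 < 1 - 2 / α := by
    rw [sub_pos, div_lt_one hα0]; exact hα
  have hu : Tendsto (fun r : ℝ => a * r ^ (-α)) atTop (𝓝 0) := by
    simpa using (tendsto_rpow_neg_atTop hα0).const_mul a
  have h1 : Tendsto (fun r : ℝ => a ^ (2 / α) * lowerGamma (1 - 2 / α) (a * r ^ (-α))) atTop
      (𝓝 0) := by
    have := ((continuous_lowerGamma hb).tendsto 0).comp hu
    rw [lowerGamma_zero] at this
    simpa using this.const_mul (a ^ (2 / α))
  have h2 : Tendsto (fun r : ℝ => r ^ 2 * (1 - Real.exp (-(a * r ^ (-α))))) atTop (𝓝 0) := by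
    have hb2 : Tendsto (fun r : ℝ => a * r ^ (-(α - 2))) atTop (𝓝 0) := by
      simpa using (tendsto_rpow_neg_atTop (by linarith : 0 < α - 2)).const_mul a
    refine squeeze_zero' ?_ ?_ hb2
    · filter_upwards [eventually_gt_atTop 0] with r hr
      have : Real.exp (-(a * r ^ (-α))) ≤ 1 :=
        Real.exp_le_one_iff.2 (neg_nonpos.2 (by positivity))
      have := sub_nonneg.2 this
      positivity
    · filter_upwards [eventually_gt_atTop 0] with r hr
      have h3 := Real.add_one_le_exp (-(a * r ^ (-α)))
      calc r ^ 2 * (1 - Real.exp (-(a * r ^ (-α)))) ≤ r ^ 2 * (a * r ^ (-α)) := by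
            gcongr; linarith
        _ = a * r ^ (-(α - 2)) := by
            rw [show -(α - 2) = -α + (2 : ℕ) by push_cast; ring, Real.rpow_add hr,
              Real.rpow_natCast]
            ring
  have h := h1.sub h2
  rwa [sub_zero] at h

lemma integral_Ioi_tail (hα : 2 < α) (ha : 0 < a) {R : ℝ} (hR : 0 < R) :
    ∫ r in Set.Ioi R, 2 * r * (1 - Real.exp (-(a * r ^ (-α)))) = tailPrimitive α a R := by
  have h := integral_Ioi_of_hasDerivAt_of_nonneg' (g := fun r => -tailPrimitive α a r)
    (g' := fun r => 2 * r * (1 - Real.exp (-(a * r ^ (-α))))) (a := R) (l := 0)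
    (fun r hr => by
      have h := (hasDerivAt_tailPrimitive hα ha (hR.trans_le hr)).neg
      rwa [neg_neg] at h)
    (fun r hr => by
      have hr0 : 0 < r := hR.trans hr
      have : Real.exp (-(a * r ^ (-α))) ≤ 1 :=
        Real.exp_le_one_iff.2 (neg_nonpos.2 (by positivity))
      have := sub_nonneg.2 this
      positivity)
    (by simpa using (tendsto_tailPrimitive hα ha).neg)
  rw [h]; ring

lemma measurable_pathLoss (α : ℝ) : Measurable (pathLoss α) := by
  unfold pathLoss; fun_prop

lemma pathLoss_nonneg (α : ℝ) (x : ℂ) : 0 ≤ pathLoss α x :=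
  Real.rpow_nonneg (zero_le_one.trans (le_max_right _ _)) _

lemma integrable_pathLoss (hα : 2 < α) : Integrable (pathLoss α) := by
  have h := (integrable_one_add_norm (E := ℂ) (μ := volume) (r := α) (by simpa using hα)).const_mul
    ((2 : ℝ) ^ α)
  refine h.mono' (measurable_pathLoss α).aestronglyMeasurable (Eventually.of_forall fun x => ?_)
  rw [Real.norm_eq_abs, abs_of_nonneg (pathLoss_nonneg α x)]
  have hx := norm_nonneg x
  have h1 : (1 + ‖x‖) / 2 ≤ max ‖x‖ 1 := by
    have := le_max_left ‖x‖ 1; have := le_max_right ‖x‖ 1; linarith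
  calc pathLoss α x ≤ ((1 + ‖x‖) / 2) ^ (-α) :=
        Real.rpow_le_rpow_of_nonpos (by positivity) h1 (by linarith)
    _ = 2 ^ α * (1 + ‖x‖) ^ (-α) := by
        rw [Real.div_rpow (by positivity) (by norm_num), Real.rpow_neg zero_le_two, div_inv_eq_mul,
          mul_comm]

lemma integrable_one_sub_exp_pathLoss (hα : 2 < α) (ha : 0 ≤ a) :
    Integrable fun x => 1 - Real.exp (-(a * pathLoss α x)) := by
  refine ((integrable_pathLoss hα).const_mul a).mono'
    (by have := measurable_pathLoss α; fun_prop) (Eventually.of_forall fun x => ?_)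
  have h0 : 0 ≤ a * pathLoss α x := mul_nonneg ha (pathLoss_nonneg α x)
  have h1 := Real.add_one_le_exp (-(a * pathLoss α x))
  have h2 : Real.exp (-(a * pathLoss α x)) ≤ 1 := Real.exp_le_one_iff.2 (by linarith)
  rw [Real.norm_eq_abs, abs_of_nonneg (by linarith)]
  linarith

lemma setIntegral_closedBall_of_le_one {ρ : ℝ} (hρ : 0 < ρ) (hρ1 : ρ ≤ 1) :
    ∫ x in Metric.closedBall (0 : ℂ) ρ, (1 - Real.exp (-(a * pathLoss α x))) =
      Real.pi * (ρ ^ 2 - ρ ^ 2 * Real.exp (-a)) := by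
  rw [setIntegral_congr_fun (g := fun _ => 1 - Real.exp (-a)) measurableSet_closedBall]
  · rw [setIntegral_const, measureReal_def, Complex.volume_closedBall]
    simp [hρ.le]
    ring
  · intro x hx
    have : max ‖x‖ 1 = 1 := max_eq_right ((mem_closedBall_zero_iff.1 hx).trans hρ1)
    simp [pathLoss, this]

lemma setIntegral_compl_closedBall_of_one_le (hα : 2 < α) (ha : 0 ≤ a) {ρ : ℝ} (hρ : 1 ≤ ρ) :
    ∫ x in (Metric.closedBall (0 : ℂ) ρ)ᶜ, (1 - Real.exp (-(a * pathLoss α x))) =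
      Real.pi * tailPrimitive α a ρ := by
  rcases ha.eq_or_lt with rfl | ha
  · have : 2 / α ≠ 0 := by positivity
    simp [tailPrimitive, Real.zero_rpow this]
  rw [← integral_indicator measurableSet_closedBall.compl]
  have h := integral_fun_norm_addHaar (volume : Measure ℂ)
    ((Set.Ioi ρ).indicator fun r => 1 - Real.exp (-(a * r ^ (-α))))
  have e : (Metric.closedBall (0 : ℂ) ρ)ᶜ.indicator
      (fun x => 1 - Real.exp (-(a * pathLoss α x))) =
      fun x => (Set.Ioi ρ).indicator (fun r => 1 - Real.exp (-(a * r ^ (-α)))) ‖x‖ := by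
    ext x
    by_cases hx : ρ < ‖x‖
    · rw [Set.indicator_of_mem (by simpa using hx), Set.indicator_of_mem (by simpa using hx),
        pathLoss, max_eq_left (hρ.trans hx.le)]
    · rw [Set.indicator_of_notMem (by simpa using hx), Set.indicator_of_notMem (by simpa using hx)]
  rw [e, h, ← integral_Ioi_tail hα ha (zero_lt_one.trans_le hρ)]
  have e2 : ∫ y in Set.Ioi (0 : ℝ), y ^ (Module.finrank ℝ ℂ - 1) •
      (Set.Ioi ρ).indicator (fun r => 1 - Real.exp (-(a * r ^ (-α)))) y =
      ∫ r in Set.Ioi ρ, r * (1 - Real.exp (-(a * r ^ (-α)))) := by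
    have e3 : ∀ y : ℝ, y ^ (Module.finrank ℝ ℂ - 1) •
        (Set.Ioi ρ).indicator (fun r => 1 - Real.exp (-(a * r ^ (-α)))) y =
        (Set.Ioi ρ).indicator (fun r => r * (1 - Real.exp (-(a * r ^ (-α))))) y := by
      intro y
      by_cases hy : y ∈ Set.Ioi ρ <;> simp [hy]
    simp_rw [e3]
    rw [setIntegral_indicator measurableSet_Ioi, Set.Ioi_inter_Ioi,
      max_eq_right (zero_le_one.trans hρ)]
  rw [e2]
  simp_rw [mul_assoc (2 : ℝ)]
  rw [integral_const_mul, measureReal_def, Complex.volume_ball]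
  simp
  ring

lemma integral_one_sub_exp_pathLoss (hα : 2 < α) (ha : 0 ≤ a) :
    ∫ x, (1 - Real.exp (-(a * pathLoss α x))) =
      Real.pi * (a ^ (2 / α) * lowerGamma (1 - 2 / α) a) := by
  rw [← integral_add_compl (measurableSet_closedBall (x := (0 : ℂ)) (ε := 1))
    (integrable_one_sub_exp_pathLoss hα ha), setIntegral_closedBall_of_le_one one_pos le_rfl,
    setIntegral_compl_closedBall_of_one_le hα ha le_rfl]
  simp [tailPrimitive]
  ring

end RadialIntegrals

/-! ### The conditional mean of the factor of a beacon -/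

/-- The conditional mean of `exp (-s * power)` for a beacon at `x`. Only the marks with at most `N`
active sectors have positive probability. -/
noncomputable def meanFactor (N : ℕ) (lams Pp σ α ρ s : ℝ) (x : ℂ) : ℝ :=
  ∑ c ∈ Finset.Icc 0 N ×ˢ Finset.univ,
    markProb N lams ρ x c * Real.exp (-(s * beaconPower N Pp σ α x c))

lemma markProb_nonneg (N : ℕ) {lams : ℝ} (hlams : 0 < lams) (ρ : ℝ) (x : ℂ) (c : ℕ × Bool) :
    0 ≤ markProb N lams ρ x c := by
  unfold markProb
  split_ifs
  exacts [eta_nonneg N hlams ρ x _, etaOff_nonneg N hlams ρ x _]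

lemma markProb_eq_zero {N : ℕ} (hN : 1 ≤ N) (lams ρ : ℝ) (x : ℂ) {c : ℕ × Bool}
    (hc : c ∉ Finset.Icc 0 N ×ˢ (Finset.univ : Finset Bool)) : markProb N lams ρ x c = 0 := by
  have hlt : N < c.1 := by
    by_contra h
    exact hc (Finset.mem_product.2 ⟨Finset.mem_Icc.2 ⟨Nat.zero_le _, not_lt.1 h⟩,
      Finset.mem_univ _⟩)
  unfold markProb
  rw [eta_eq_zero_of_lt hN lams ρ x hlt, etaOff_eq_zero_of_le hN lams ρ x hlt.le, ite_self]

lemma gain_pos {N : ℕ} (hN : 1 ≤ N) (M : ℕ) : 0 < gain N M := by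
  unfold gain
  split_ifs with h
  · exact one_pos
  · have : 0 < M := Nat.pos_of_ne_zero h
    positivity

lemma gain_le {N : ℕ} (hN : 1 ≤ N) (M : ℕ) : gain N M ≤ N := by
  unfold gain
  split_ifs with h
  · exact_mod_cast hN
  · exact div_le_self (by positivity) (by exact_mod_cast Nat.pos_of_ne_zero h)

section Power

variable {N : ℕ} {Pp σ α : ℝ}

lemma beaconPower_nonneg (hN : 1 ≤ N) (hPp : 0 < Pp) (hσ : 0 < σ) (x : ℂ) (c : ℕ × Bool) :
    0 ≤ beaconPower N Pp σ α x c := by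
  have := gain_pos hN c.1
  have := pathLoss_nonneg α x
  unfold beaconPower
  split_ifs <;> positivity

lemma beaconPower_le (hN : 1 ≤ N) (hPp : 0 < Pp) (hσ : 0 < σ) (x : ℂ) (c : ℕ × Bool) :
    beaconPower N Pp σ α x c ≤ Pp * N * σ * pathLoss α x := by
  have h1 := gain_le hN c.1
  have h2 := pathLoss_nonneg α x
  unfold beaconPower
  split_ifs
  · gcongr
  · positivity

lemma measurable_beaconPower (N : ℕ) (Pp σ α : ℝ) (c : ℕ × Bool) :
    Measurable fun x => beaconPower N Pp σ α x c := by
  unfold beaconPower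
  split_ifs
  · exact (measurable_pathLoss α).const_mul _
  · exact measurable_const

lemma measurable_beaconPower_comp {Ω : Type*} [MeasurableSpace Ω] (N : ℕ) (Pp σ α : ℝ)
    {X : Ω → ℂ} {T : Ω → ℕ × Bool} (hX : Measurable X) (hT : Measurable T) :
    Measurable fun ω => beaconPower N Pp σ α (X ω) (T ω) := by
  have h : Measurable fun p : ℂ × (ℕ × Bool) => beaconPower N Pp σ α p.1 p.2 :=
    measurable_from_prod_countable_left fun c => measurable_beaconPower N Pp σ α c
  exact h.comp (hX.prodMk hT)

end Power

section MeanFactor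

variable {Ω' : Type*} [MeasurableSpace Ω'] {Q : Measure Ω'} [IsProbabilityMeasure Q]
  {N : ℕ} {lams Pp σ α ρ s : ℝ} {Y : ℕ → Ω' → ℂ}

lemma sum_markProb (hY : IsPoissonProcess Q lams Y) (hN : 1 ≤ N) (hlams : 0 < lams)
    (hρ : 0 < ρ) (x : ℂ) :
    ∑ c ∈ Finset.Icc 0 N ×ˢ Finset.univ, markProb N lams ρ x c = 1 := by
  have h := tsum_stateProb hY hN hlams hρ (fun _ => 0) x
  simp_rw [stateProb_eq hY hN hlams hρ] at h
  rw [tsum_eq_sum (s := Finset.Icc 0 N ×ˢ Finset.univ) fun c hc => by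
      rw [markProb_eq_zero hN lams ρ x hc, ENNReal.ofReal_zero],
    ← ENNReal.ofReal_sum_of_nonneg fun c _ => markProb_nonneg N hlams ρ x c] at h
  exact ENNReal.ofReal_eq_one.1 h

lemma tsum_stateProb_mul (hY : IsPoissonProcess Q lams Y) (hN : 1 ≤ N) (hlams : 0 < lams)
    (hρ : 0 < ρ) (φ : ℂ → ℝ) (x : ℂ) :
    ∑' c, stateProb Q Y N ρ φ x c * ENNReal.ofReal (Real.exp (-(s * beaconPower N Pp σ α x c))) =
      ENNReal.ofReal (meanFactor N lams Pp σ α ρ s x) := by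
  simp_rw [stateProb_eq hY hN hlams hρ]
  rw [tsum_eq_sum (s := Finset.Icc 0 N ×ˢ Finset.univ) fun c hc => by
      rw [markProb_eq_zero hN lams ρ x hc, ENNReal.ofReal_zero, zero_mul],
    meanFactor, ENNReal.ofReal_sum_of_nonneg fun c _ =>
      mul_nonneg (markProb_nonneg N hlams ρ x c) (Real.exp_pos _).le]
  exact Finset.sum_congr rfl fun c _ => (ENNReal.ofReal_mul (markProb_nonneg N hlams ρ x c)).symm

/-- The beacons that do not radiate towards the origin do not contribute. -/
lemma one_sub_meanFactor (hY : IsPoissonProcess Q lams Y) (hN : 1 ≤ N) (hlams : 0 < lams)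
    (hρ : 0 < ρ) (x : ℂ) :
    1 - meanFactor N lams Pp σ α ρ s x =
      ∑ M ∈ Finset.Icc 0 N, eta N lams ρ x M *
        (1 - Real.exp (-(s * Pp * σ * gain N M * pathLoss α x))) := by
  rw [show 1 - meanFactor N lams Pp σ α ρ s x =
      ∑ c ∈ Finset.Icc 0 N ×ˢ Finset.univ, markProb N lams ρ x c -
        meanFactor N lams Pp σ α ρ s x by rw [sum_markProb hY hN hlams hρ x],
    meanFactor, ← Finset.sum_sub_distrib, Finset.sum_product]
  refine Finset.sum_congr rfl fun M _ => ?_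
  simp only [Fintype.sum_bool, markProb_true, markProb_false, beaconPower, if_true,
    Bool.false_eq_true, if_false, mul_zero, neg_zero, Real.exp_zero, mul_one, sub_self, add_zero]
  rw [show s * (Pp * gain N M * σ * pathLoss α x) = s * Pp * σ * gain N M * pathLoss α x by ring]
  ring

lemma measurable_meanFactor (N : ℕ) (lams Pp σ α ρ s : ℝ) :
    Measurable (meanFactor N lams Pp σ α ρ s) := by
  unfold meanFactor
  exact Finset.measurable_sum _ fun c _ => (measurable_markProb N lams ρ c).mul
    ((measurable_beaconPower N Pp σ α c).const_mul s).neg.exp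

lemma exp_le_meanFactor (hY : IsPoissonProcess Q lams Y) (hN : 1 ≤ N) (hlams : 0 < lams)
    (hρ : 0 < ρ) (hPp : 0 < Pp) (hσ : 0 < σ) (hs : 0 ≤ s) (x : ℂ) :
    Real.exp (-(s * (Pp * N * σ * pathLoss α x))) ≤ meanFactor N lams Pp σ α ρ s x := by
  rw [← one_mul (Real.exp _), ← sum_markProb hY hN hlams hρ x, Finset.sum_mul]
  refine Finset.sum_le_sum fun c _ => ?_
  have h1 := beaconPower_le (α := α) hN hPp hσ x c
  have h2 := markProb_nonneg N hlams ρ x c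
  gcongr

lemma meanFactor_le_one (hY : IsPoissonProcess Q lams Y) (hN : 1 ≤ N) (hlams : 0 < lams)
    (hρ : 0 < ρ) (hPp : 0 < Pp) (hσ : 0 < σ) (hs : 0 ≤ s) (x : ℂ) :
    meanFactor N lams Pp σ α ρ s x ≤ 1 := by
  rw [← sum_markProb hY hN hlams hρ x]
  refine Finset.sum_le_sum fun c _ => mul_le_of_le_one_right (markProb_nonneg N hlams ρ x c) ?_
  exact Real.exp_le_one_iff.2 (neg_nonpos.2 (mul_nonneg hs (beaconPower_nonneg hN hPp hσ x c)))

end MeanFactor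

/-! ### The Laplace transform of the aggregate power -/

/-- The limit of finite products of factors; it uses the summability, since otherwise the
unordered sum has the junk value `0`. -/
lemma tendsto_integral_prod_exp {Ω : Type*} [MeasurableSpace Ω] {P : Measure Ω}
    [IsProbabilityMeasure P] {f : ℕ → Ω → ℝ} (hm : ∀ i, Measurable (f i)) (h0 : ∀ i ω, 0 ≤ f i ω)
    (hs : ∀ᵐ ω ∂P, Summable fun i => f i ω) :
    Tendsto (fun n => ∫ ω, ∏ i : Fin n, Real.exp (-f i ω) ∂P) atTop
      (𝓝 (∫ ω, Real.exp (-∑' i, f i ω) ∂P)) := by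
  refine tendsto_integral_of_dominated_convergence (fun _ => 1)
    (fun n => (Finset.measurable_prod (f := fun (i : Fin n) ω => Real.exp (-f i ω)) _
      fun i _ => (hm i).neg.exp).aestronglyMeasurable)
    (integrable_const 1) (fun n => Eventually.of_forall fun ω => ?_) ?_
  · rw [Real.norm_eq_abs, abs_of_nonneg (Finset.prod_nonneg fun i _ => (Real.exp_pos _).le)]
    exact Finset.prod_le_one (fun i _ => (Real.exp_pos _).le) fun i _ =>
      Real.exp_le_one_iff.2 (neg_nonpos.2 (h0 _ _))
  · filter_upwards [hs] with ω hω
    have h := (Real.continuous_exp.tendsto _).comp hω.hasSum.tendsto_sum_nat.neg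
    refine h.congr fun n => ?_
    rw [Function.comp_apply, ← Finset.sum_neg_distrib, Real.exp_sum, Finset.prod_range]

section Laplace

variable {Ω Ω' : Type*} [MeasurableSpace Ω] [MeasurableSpace Ω']
  {P : Measure Ω} {Q : Measure Ω'} [IsProbabilityMeasure Q]
  {N : ℕ} {lamp lams Pp σ α ρ s : ℝ} {φ : ℂ → ℝ} {X : ℕ → Ω → ℂ} {Y : ℕ → Ω' → ℂ}
  {T : ℕ → Ω → ℕ × Bool}

lemma ae_summable_beaconPower (hN : 1 ≤ N) (hlamp : 0 < lamp) (hPp : 0 < Pp) (hσ : 0 < σ)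
    (hα : 2 < α) (hX : IsPoissonProcess P lamp X) :
    ∀ᵐ ω ∂P, Summable fun i => beaconPower N Pp σ α (X i ω) (T i ω) := by
  filter_upwards [hX.ae_summable hlamp (measurable_pathLoss α) (integrable_pathLoss hα)] with ω hω
  exact Summable.of_nonneg_of_le (fun i => beaconPower_nonneg hN hPp hσ _ _)
    (fun i => beaconPower_le hN hPp hσ _ _) (hω.mul_left (Pp * N * σ))

/-- With a single sector every beacon radiates towards the origin with unit gain. -/
lemma ae_aggregatePower_one_eq (hlams : 0 < lams) (hρ : 0 < ρ) (hY : IsPoissonProcess Q lams Y)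
    (hT : IsIndependentMarking P X (stateProb Q Y 1 ρ φ) T) :
    ∀ᵐ ω ∂P, aggregatePower 1 Pp σ α X T ω = omniPower Pp σ α X ω := by
  have hK : ∀ c : ℕ × Bool, (c ≠ (0, true) ∧ c ≠ (1, true)) →
      ∀ x, stateProb Q Y 1 ρ φ x c = 0 := by
    rintro ⟨M, b⟩ ⟨h0, h1⟩ x
    rw [stateProb_eq hY le_rfl hlams hρ]
    cases b
    · rcases Nat.eq_zero_or_pos M with rfl | hM
      · simp [etaOff]
      · simp [etaOff_eq_zero_of_le le_rfl lams ρ x (show 1 ≤ M from hM)]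
    · have hM : 1 < M := by
        simp only [ne_eq, Prod.mk.injEq, and_true] at h0 h1
        omega
      simp [eta_eq_zero_of_lt le_rfl lams ρ x hM]
  have h : ∀ᵐ ω ∂P, ∀ c : ℕ × Bool, (c ≠ (0, true) ∧ c ≠ (1, true)) → ∀ i, T i ω ≠ c := by
    refine ae_all_iff.2 fun c => ?_
    by_cases hc : c ≠ (0, true) ∧ c ≠ (1, true)
    · filter_upwards [hT.ae_ne (hK c hc)] with ω hω _ using hω
    · exact Eventually.of_forall fun ω h' => absurd h' hc
  filter_upwards [h] with ω hω
  rw [aggregatePower, omniPower, ← tsum_mul_left]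
  refine tsum_congr fun i => ?_
  have hi : T i ω = (0, true) ∨ T i ω = (1, true) := by
    by_contra hcon
    exact hω (T i ω) (not_or.1 hcon) i rfl
  rcases hi with hi | hi <;> simp [hi, beaconPower, gain]

lemma integral_prod_exp_beaconPower (hN : 1 ≤ N) (hlams : 0 < lams) (hPp : 0 < Pp) (hσ : 0 < σ)
    (hρ : 0 < ρ) (hs : 0 ≤ s) (hX : IsPoissonProcess P lamp X) (hY : IsPoissonProcess Q lams Y)
    (hT : IsIndependentMarking P X (stateProb Q Y N ρ φ) T) (n : ℕ) :
    ∫ ω, ∏ i : Fin n, Real.exp (-(s * beaconPower N Pp σ α (X i ω) (T i ω))) ∂P =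
      ∫ ω, ∏ i : Fin n, meanFactor N lams Pp σ α ρ s (X i ω) ∂P := by
  have hpos : ∀ x, 0 ≤ meanFactor N lams Pp σ α ρ s x := fun x =>
    (Real.exp_pos _).le.trans (exp_le_meanFactor hY hN hlams hρ hPp hσ hs x)
  rw [integral_eq_lintegral_of_nonneg_ae, integral_eq_lintegral_of_nonneg_ae]
  · simp_rw [ENNReal.ofReal_prod_of_nonneg fun (i : Fin n) _ => hpos _,
      ENNReal.ofReal_prod_of_nonneg fun (i : Fin n) _ => (Real.exp_pos _).le]
    have h := hT.lintegral_prod hX.measurable (measurable_stateProb hY hN hlams hρ φ)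
      (g := fun x c => ENNReal.ofReal (Real.exp (-(s * beaconPower N Pp σ α x c))))
      (fun c => ((measurable_beaconPower N Pp σ α c).const_mul s).neg.exp.ennreal_ofReal) n
    simp_rw [tsum_stateProb_mul hY hN hlams hρ φ] at h
    rw [h]
  · exact Eventually.of_forall fun ω => Finset.prod_nonneg fun i _ => hpos _
  · exact (Finset.measurable_prod
      (f := fun (i : Fin n) ω => meanFactor N lams Pp σ α ρ s (X i ω)) _ fun i _ =>
        (measurable_meanFactor N lams Pp σ α ρ s).comp (hX.measurable i)).aestronglyMeasurable
  · exact Eventually.of_forall fun ω => Finset.prod_nonneg fun i _ => (Real.exp_pos _).le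
  · exact (Finset.measurable_prod
      (f := fun (i : Fin n) ω => Real.exp (-(s * beaconPower N Pp σ α (X i ω) (T i ω)))) _
      fun i _ => ((measurable_beaconPower_comp N Pp σ α (hX.measurable i)
        (hT.measurable i)).const_mul s).neg.exp).aestronglyMeasurable

variable [IsProbabilityMeasure P]

/-- The Laplace transform of the aggregate power: integrating out the marks replaces every factor
by its conditional mean, and the probability generating functional applies to the result. -/
theorem laplace_aggregatePower (hN : 1 ≤ N) (hlamp : 0 < lamp) (hlams : 0 < lams) (hPp : 0 < Pp)
    (hσ : 0 < σ) (hα : 2 < α) (hρ : 0 < ρ) (hs : 0 ≤ s) (hX : IsPoissonProcess P lamp X)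
    (hY : IsPoissonProcess Q lams Y)
    (hT : IsIndependentMarking P X (stateProb Q Y N ρ φ) T) :
    laplace P (aggregatePower N Pp σ α X T) s =
      Real.exp (-(lamp * ∫ x, ∑ M ∈ Finset.Icc 0 N, eta N lams ρ x M *
        (1 - Real.exp (-(s * Pp * σ * gain N M * pathLoss α x))))) := by
  set f : ℂ → ℝ := fun x => -Real.log (meanFactor N lams Pp σ α ρ s x) with hf
  have hlow := exp_le_meanFactor (α := α) hY hN hlams hρ hPp hσ hs
  have hpos : ∀ x, 0 < meanFactor N lams Pp σ α ρ s x := fun x => (Real.exp_pos _).trans_le (hlow x)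
  have hexp : ∀ x, Real.exp (-f x) = meanFactor N lams Pp σ α ρ s x := fun x => by
    rw [hf, neg_neg, Real.exp_log (hpos x)]
  have hf0 : 0 ≤ f := fun x => neg_nonneg.2
    (Real.log_nonpos (hpos x).le (meanFactor_le_one hY hN hlams hρ hPp hσ hs x))
  have hfm : Measurable f := (measurable_meanFactor N lams Pp σ α ρ s).log.neg
  have hfi : Integrable f := by
    refine ((integrable_pathLoss hα).const_mul (s * (Pp * N * σ))).mono' hfm.aestronglyMeasurable
      (Eventually.of_forall fun x => ?_)
    rw [Real.norm_eq_abs, abs_of_nonneg (hf0 x), hf, neg_le, ← Real.log_exp (-(_ * _))]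
    refine Real.log_le_log (Real.exp_pos _) ?_
    rw [mul_assoc s]
    exact hlow x
  have h1 := tendsto_integral_prod_exp (P := P)
    (f := fun i ω => s * beaconPower N Pp σ α (X i ω) (T i ω))
    (fun i => (measurable_beaconPower_comp N Pp σ α (hX.measurable i)
      (hT.measurable i)).const_mul s)
    (fun i ω => mul_nonneg hs (beaconPower_nonneg hN hPp hσ _ _))
    ((ae_summable_beaconPower hN hlamp hPp hσ hα hX).mono fun ω hω => hω.mul_left s)
  have h2 := tendsto_integral_prod_exp (P := P) (f := fun i ω => f (X i ω))
    (fun i => hfm.comp (hX.measurable i)) (fun i ω => hf0 _) (hX.ae_summable hlamp hfm hfi)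
  simp_rw [hexp, ← integral_prod_exp_beaconPower hN hlams hPp hσ hρ hs hX hY hT] at h2
  have h3 := tendsto_nhds_unique h1 h2
  rw [hX.integral_exp_neg_tsum hlamp hfm hfi hf0] at h3
  simp_rw [hexp, one_sub_meanFactor hY hN hlams hρ] at h3
  rw [← h3]
  simp only [laplace, aggregatePower, tsum_mul_left, neg_mul]

lemma laplace_omniPower (hlamp : 0 < lamp) (hPp : 0 < Pp) (hσ : 0 < σ) (hα : 2 < α)
    (hs : 0 ≤ s) (hX : IsPoissonProcess P lamp X) :
    laplace P (omniPower Pp σ α X) s = Real.exp (-(lamp * Real.pi * (s * Pp * σ) ^ (2 / α) *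
      lowerGamma (1 - 2 / α) (s * Pp * σ))) := by
  have ha : 0 ≤ s * Pp * σ := by positivity
  have h := hX.integral_exp_neg_tsum hlamp ((measurable_pathLoss α).const_mul (s * Pp * σ))
    ((integrable_pathLoss hα).const_mul _) (fun x => mul_nonneg ha (pathLoss_nonneg α x))
  rw [integral_one_sub_exp_pathLoss hα ha] at h
  rw [show lamp * Real.pi * (s * Pp * σ) ^ (2 / α) * lowerGamma (1 - 2 / α) (s * Pp * σ) =
    lamp * (Real.pi * ((s * Pp * σ) ^ (2 / α) * lowerGamma (1 - 2 / α) (s * Pp * σ))) by ring, ← h]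
  simp only [laplace, omniPower, tsum_mul_left]
  congr 1 with ω
  ring_nf

end Laplace

/-! ### Near and far beacons -/

lemma integral_sum_eta {N : ℕ} (lams : ℝ) {α : ℝ} (hα : 2 < α) (ρ : ℝ)
    {a : ℕ → ℝ} (ha : ∀ M, 0 ≤ a M) :
    ∫ x, ∑ M ∈ Finset.Icc 0 N, eta N lams ρ x M * (1 - Real.exp (-(a M * pathLoss α x))) =
      (∑ M ∈ Finset.Icc 1 N, etaNear N lams ρ M *
        ∫ x in Metric.closedBall (0 : ℂ) ρ, (1 - Real.exp (-(a M * pathLoss α x)))) +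
      ∑ M ∈ Finset.Icc 0 N, etaFar N lams ρ M *
        ∫ x in (Metric.closedBall (0 : ℂ) ρ)ᶜ, (1 - Real.exp (-(a M * pathLoss α x))) := by
  have hint := fun M => integrable_one_sub_exp_pathLoss hα (ha M)
  have hB : MeasurableSet (Metric.closedBall (0 : ℂ) ρ) := measurableSet_closedBall
  have hsplit : ∀ x M, eta N lams ρ x M * (1 - Real.exp (-(a M * pathLoss α x))) =
      (if M = 0 then 0 else etaNear N lams ρ M) * (Metric.closedBall (0 : ℂ) ρ).indicator
        (fun x => 1 - Real.exp (-(a M * pathLoss α x))) x +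
      etaFar N lams ρ M * (Metric.closedBall (0 : ℂ) ρ)ᶜ.indicator
        (fun x => 1 - Real.exp (-(a M * pathLoss α x))) x := by
    intro x M
    by_cases hx : ‖x‖ ≤ ρ
    · have h1 : x ∈ Metric.closedBall (0 : ℂ) ρ := by simpa using hx
      simp [eta, hx, h1]
    · have h1 : x ∉ Metric.closedBall (0 : ℂ) ρ := by simpa using hx
      simp [eta, hx, h1]
  simp_rw [hsplit]
  rw [integral_finsetSum (f := fun M x => (if M = 0 then 0 else etaNear N lams ρ M) *
        (Metric.closedBall (0 : ℂ) ρ).indicator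
        (fun x => 1 - Real.exp (-(a M * pathLoss α x))) x +
      etaFar N lams ρ M * (Metric.closedBall (0 : ℂ) ρ)ᶜ.indicator
        (fun x => 1 - Real.exp (-(a M * pathLoss α x))) x) _ fun M _ =>
      (((hint M).indicator hB).const_mul _).add
    (((hint M).indicator hB.compl).const_mul _)]
  have hone : ∀ M, ∫ x, ((if M = 0 then 0 else etaNear N lams ρ M) *
        (Metric.closedBall (0 : ℂ) ρ).indicator
        (fun x => 1 - Real.exp (-(a M * pathLoss α x))) x +
      etaFar N lams ρ M * (Metric.closedBall (0 : ℂ) ρ)ᶜ.indicator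
        (fun x => 1 - Real.exp (-(a M * pathLoss α x))) x) =
      (if M = 0 then 0 else etaNear N lams ρ M) *
        (∫ x in Metric.closedBall (0 : ℂ) ρ, (1 - Real.exp (-(a M * pathLoss α x)))) +
      etaFar N lams ρ M *
        ∫ x in (Metric.closedBall (0 : ℂ) ρ)ᶜ, (1 - Real.exp (-(a M * pathLoss α x))) := by
    intro M
    rw [integral_add (((hint M).indicator hB).const_mul _)
      (((hint M).indicator hB.compl).const_mul _), integral_const_mul, integral_const_mul,
      integral_indicator hB, integral_indicator hB.compl]
  simp_rw [hone]
  rw [Finset.sum_add_distrib]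
  congr 1
  symm
  refine Finset.sum_subset_zero_on_sdiff (Finset.Icc_subset_Icc_left zero_le_one) ?_ ?_
  · intro M hM
    have : M = 0 := by
      simp only [Finset.mem_sdiff, Finset.mem_Icc] at hM
      omega
    simp [this]
  · intro M hM
    have : M ≠ 0 := by
      have := (Finset.mem_Icc.1 hM).1
      omega
    simp [this]

lemma setIntegral_compl_closedBall_of_le_one {α a : ℝ} (hα : 2 < α) (ha : 0 ≤ a) {ρ : ℝ}
    (hρ : 0 < ρ) (hρ1 : ρ ≤ 1) :
    ∫ x in (Metric.closedBall (0 : ℂ) ρ)ᶜ, (1 - Real.exp (-(a * pathLoss α x))) =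
      -(Real.pi * (ρ ^ 2 - ρ ^ 2 * Real.exp (-a) - a ^ (2 / α) * lowerGamma (1 - 2 / α) a)) := by
  have h := integral_add_compl (measurableSet_closedBall (x := (0 : ℂ)) (ε := ρ))
    (integrable_one_sub_exp_pathLoss hα ha)
  rw [setIntegral_closedBall_of_le_one hρ hρ1, integral_one_sub_exp_pathLoss hα ha] at h
  linear_combination h

lemma setIntegral_closedBall_of_one_le {α a : ℝ} (hα : 2 < α) (ha : 0 ≤ a) {ρ : ℝ}
    (hρ : 1 ≤ ρ) :
    ∫ x in Metric.closedBall (0 : ℂ) ρ, (1 - Real.exp (-(a * pathLoss α x))) =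
      Real.pi * (ρ ^ 2 - ρ ^ 2 * Real.exp (-(a * ρ ^ (-α))) + a ^ (2 / α) *
        (lowerGamma (1 - 2 / α) a - lowerGamma (1 - 2 / α) (a * ρ ^ (-α)))) := by
  have h := integral_add_compl (measurableSet_closedBall (x := (0 : ℂ)) (ε := ρ))
    (integrable_one_sub_exp_pathLoss hα ha)
  rw [setIntegral_compl_closedBall_of_one_le hα ha hρ, integral_one_sub_exp_pathLoss hα ha,
    tailPrimitive] at h
  linear_combination h

end WPT

theorem proposition1
    {Ω Ω' : Type*} [MeasurableSpace Ω] [MeasurableSpace Ω']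
    (P : Measure Ω) [IsProbabilityMeasure P] (Q : Measure Ω') [IsProbabilityMeasure Q]
    (N : ℕ) (hN : 1 ≤ N)
    (lamp lams Pp σ α ρ : ℝ) (hlamp : 0 < lamp) (hlams : 0 < lams) (hPp : 0 < Pp) (hσ : 0 < σ)
    (hα : 2 < α) (hρ : 0 < ρ) (φ : ℂ → ℝ)
    (X : ℕ → Ω → ℂ) (hX : WPT.IsPoissonProcess P lamp X)
    (Y : ℕ → Ω' → ℂ) (hY : WPT.IsPoissonProcess Q lams Y)
    (T : ℕ → Ω → ℕ × Bool)
    (hT : WPT.IsIndependentMarking P X (WPT.stateProb Q Y N ρ φ) T) :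
    (∀ᵐ ω ∂P, Summable fun i => WPT.beaconPower N Pp σ α (X i ω) (T i ω)) ∧
    (∀ᵐ ω ∂P, Summable fun i => WPT.pathLoss α (X i ω)) ∧
    (ρ ≤ 1 → ∀ s : ℝ, 0 ≤ s →
      WPT.laplace P (WPT.aggregatePower N Pp σ α X T) s =
        (∏ M ∈ Finset.Icc 1 N, WPT.lapNearOne N lamp lams Pp σ ρ M s) *
          ∏ M ∈ Finset.Icc 0 N, WPT.lapFarOne N lamp lams Pp σ α ρ M s) ∧
    (1 < ρ → ∀ s : ℝ, 0 ≤ s →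
      WPT.laplace P (WPT.aggregatePower N Pp σ α X T) s =
        (∏ M ∈ Finset.Icc 1 N, WPT.lapNearTwo N lamp lams Pp σ α ρ M s) *
          ∏ M ∈ Finset.Icc 0 N, WPT.lapFarTwo N lamp lams Pp σ α ρ M s) ∧
    (N = 1 → ∀ᵐ ω ∂P, WPT.aggregatePower N Pp σ α X T ω = WPT.omniPower Pp σ α X ω) ∧
    (∀ s : ℝ, 0 ≤ s →
      WPT.laplace P (WPT.omniPower Pp σ α X) s =
        Real.exp (-(lamp * Real.pi * (s * Pp * σ) ^ (2 / α) *
          WPT.lowerGamma (1 - 2 / α) (s * Pp * σ)))) := by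
  have ha : ∀ s : ℝ, 0 ≤ s → ∀ M, 0 ≤ s * Pp * σ * WPT.gain N M := fun s hs M => by
    have := WPT.gain_pos hN M
    positivity
  refine ⟨WPT.ae_summable_beaconPower hN hlamp hPp hσ hα hX,
    hX.ae_summable hlamp (WPT.measurable_pathLoss α) (WPT.integrable_pathLoss hα),
    fun hρ1 s hs => ?_, fun hρ1 s hs => ?_, ?_,
    fun s hs => WPT.laplace_omniPower hlamp hPp hσ hα hs hX⟩
  · rw [WPT.laplace_aggregatePower hN hlamp hlams hPp hσ hα hρ hs hX hY hT,
      WPT.integral_sum_eta lams hα ρ (ha s hs)]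
    simp only [WPT.lapNearOne, WPT.lapFarOne]
    rw [← Real.exp_sum, ← Real.exp_sum, ← Real.exp_add, mul_add, neg_add, Finset.mul_sum,
      Finset.mul_sum, ← Finset.sum_neg_distrib, ← Finset.sum_neg_distrib]
    congr 2 <;> refine Finset.sum_congr rfl fun M _ => ?_
    · rw [WPT.setIntegral_closedBall_of_le_one hρ hρ1]
      ring
    · rw [WPT.setIntegral_compl_closedBall_of_le_one hα (ha s hs M) hρ hρ1]
      ring
  · rw [WPT.laplace_aggregatePower hN hlamp hlams hPp hσ hα hρ hs hX hY hT,
      WPT.integral_sum_eta lams hα ρ (ha s hs)]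
    simp only [WPT.lapNearTwo, WPT.lapFarTwo]
    rw [← Real.exp_sum, ← Real.exp_sum, ← Real.exp_add, mul_add, neg_add, Finset.mul_sum,
      Finset.mul_sum, ← Finset.sum_neg_distrib, ← Finset.sum_neg_distrib]
    congr 2 <;> refine Finset.sum_congr rfl fun M _ => ?_
    · rw [WPT.setIntegral_closedBall_of_one_le hα (ha s hs M) hρ1.le]
      ring
    · rw [WPT.setIntegral_compl_closedBall_of_one_le hα (ha s hs M) hρ1.le, WPT.tailPrimitive]
      ring
  · rintro rfl
    exact WPT.ae_aggregatePower_one_eq hlams hρ hY hT
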